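/- Let $(y(k))_{k\in\mathbb Z}$ be a zero-mean, wide-sense stationary, real Gaussian process with autocorrelation function $C(\tau)=\mathbb E[y(k)y(k-\tau)]$, let $\delta\ge 1$ be an integer, and let $x(n)=(x_1(n),x_2(n))^T=(y(n\delta+1),y(n\delta+2))^T$. Write $C_j=C(j)$ and $\gamma_i=\gamma_i(\tau)=C(\tau\delta+i)$ for $i\in\{-1,0,1\}$. Assume that the covariance matrix of $x(n)$ is invertible, i.e. $C_0^2-C_1^2\ne 0$, and that the mixing condition holds: $\sum_{\tau=0}^{\infty}S_{ab}(\tau)^2<\infty$ for all $a,b\in\{1,2\}$, where $S_{ab}(\tau)=\mathbb E[x_a(n+\tau)x_b(n)]=C(\tau\delta+a-b)$. For $N\ge1$ let $$\hat S=\frac1N\sum_{k=1}^N x(k)x(k)^T,\qquad \hat B_2=\hat B_2(N)=\frac1N\sum_{n=1}^N\big(x(n)^T\hat S^{-1}x(n)\big)^2$$ be Mardia's sample kurtosis (where $\hat S$ is singular, $\hat S^{-1}$ is read as $0$). Then $\hat B_2(N)$ is square integrable for every $N$, and, as $N\to\infty$, $$\mathbb E[\hat B_2]=8-\frac{16}{N}-\frac{4}{N^2}\sum_{\tau=1}^{N-1}\frac{(N-\tau)\,q_1(\tau)}{(C_0^2-C_1^2)^2}+o\!\left(\frac1N\right),$$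 $$\operatorname{Var}(\hat B_2)=\frac{64}{N}+\frac{16}{N^2}\sum_{\tau=1}^{N-1}\frac{(N-\tau)\,q_2(\tau)}{(C_0^2-C_1^2)^4}+o\!\left(\frac1N\right),$$ where $$q_1(\tau)=\big[(\gamma_1+\gamma_{-1})^2+8\gamma_0^2\big]C_0^2-12\,C_0C_1\,\gamma_0(\gamma_1+\gamma_{-1})+\big[2(\gamma_1+\gamma_{-1})^2+4\gamma_0^2\big]C_1^2,$$ $$\begin{aligned}q_2(\tau)={}&\big[8(\gamma_0^2-\gamma_1\gamma_{-1})^2+3(\gamma_1^2-\gamma_{-1}^2)^2+12\gamma_0^2(\gamma_1+\gamma_{-1})^2\big]C_0^4\\&+4\big[8\gamma_0^4+3(5\gamma_0^2+\gamma_1\gamma_{-1})(\gamma_1+\gamma_{-1})^2-4\gamma_1\gamma_{-1}(\gamma_0^2+\gamma_1\gamma_{-1})\big]C_0^2C_1^2\\&+8\big[\gamma_0^4+4\gamma_0^2\gamma_1\gamma_{-1}+\gamma_1^2\gamma_{-1}^2\big]C_1^4\\&-24\,C_0C_1\,\gamma_0(\gamma_1+\gamma_{-1})\big[(2\gamma_0^2+\gamma_1^2+\gamma_{-1}^2)C_0^2+2(\gamma_0^2+\gamma_1\gamma_{-1})C_1^2\big].\end{aligned}$$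 -/

import Mathlib

open MeasureTheory ProbabilityTheory Filter Asymptotics
open scoped Matrix

noncomputable section

/-- The time embedding `x(n) = (y(nδ + 1), …, y(nδ + p))` of a scalar process `y`
(the coordinates are numbered from `0` to `p - 1`, hence the shift `a + 1`). -/
def timeEmbedding {Ω : Type*} (p δ : ℕ) (y : ℤ → Ω → ℝ) (n : ℤ) (ω : Ω) : Fin p → ℝ :=
  fun a => y (n * (δ : ℤ) + ((a : ℕ) : ℤ) + 1) ω

/-- The matrix `S(τ)` with entries `S_ab(τ) = E[x_a(τ) x_b(0)]` of lagged second moments of a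
(zero-mean, wide-sense stationary) vector process `x`. -/
def laggedCov {Ω : Type*} [MeasurableSpace Ω] {p : ℕ} (μ : Measure Ω)
    (x : ℤ → Ω → Fin p → ℝ) (τ : ℤ) : Matrix (Fin p) (Fin p) ℝ :=
  Matrix.of fun a b => ∫ ω, x τ ω a * x 0 ω b ∂μ

/-- The mixing condition: `∑_{τ ≥ 0} |S_ab(τ)|²` converges for all `a, b`. -/
def IsMixing {Ω : Type*} [MeasurableSpace Ω] {p : ℕ} (μ : Measure Ω)
    (x : ℤ → Ω → Fin p → ℝ) : Prop :=
  ∀ a b : Fin p, Summable fun τ : ℕ => |laggedCov μ x (τ : ℤ) a b| ^ 2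

/-- The sample covariance `Ŝ = (1/N) ∑_{k=1}^N x(k) x(k)ᵀ`. -/
def sampleCov {Ω : Type*} {p : ℕ} (x : ℤ → Ω → Fin p → ℝ) (N : ℕ) (ω : Ω) :
    Matrix (Fin p) (Fin p) ℝ :=
  (1 / (N : ℝ)) • ∑ k ∈ Finset.Icc 1 N, Matrix.vecMulVec (x (k : ℤ) ω) (x (k : ℤ) ω)

/-- Mardia's sample multivariate kurtosis
`B̂_p(N) = (1/N) ∑_{n=1}^N (x(n)ᵀ Ŝ⁻¹ x(n))²`. -/
def mardiaKurtosis {Ω : Type*} {p : ℕ} (x : ℤ → Ω → Fin p → ℝ) (N : ℕ) (ω : Ω) : ℝ :=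
  (1 / (N : ℝ)) *
    ∑ n ∈ Finset.Icc 1 N, (x (n : ℤ) ω ⬝ᵥ ((sampleCov x N ω)⁻¹ *ᵥ x (n : ℤ) ω)) ^ 2

/-- `γ_i(τ) = C(τδ + i)`. -/
def gammaCoeff (C : ℤ → ℝ) (δ : ℕ) (i : ℤ) (τ : ℕ) : ℝ :=
  C ((τ : ℤ) * (δ : ℤ) + i)

/-- The polynomial `q₁`, in `a = C₀`, `b = C₁`, `gm = γ₋₁`, `g0 = γ₀`, `gp = γ₁`. -/
def q₁Poly (a b gm g0 gp : ℝ) : ℝ :=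
  ((gp + gm) ^ 2 + 8 * g0 ^ 2) * a ^ 2
    - 12 * a * b * g0 * (gp + gm)
    + (2 * (gp + gm) ^ 2 + 4 * g0 ^ 2) * b ^ 2

/-- The polynomial `q₂`, in `a = C₀`, `b = C₁`, `gm = γ₋₁`, `g0 = γ₀`, `gp = γ₁`. -/
def q₂Poly (a b gm g0 gp : ℝ) : ℝ :=
  (8 * (g0 ^ 2 - gp * gm) ^ 2 + 3 * (gp ^ 2 - gm ^ 2) ^ 2
      + 12 * g0 ^ 2 * (gp + gm) ^ 2) * a ^ 4
    + 4 * (8 * g0 ^ 4 + 3 * (5 * g0 ^ 2 + gp * gm) * (gp + gm) ^ 2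
      - 4 * gp * gm * (g0 ^ 2 + gp * gm)) * a ^ 2 * b ^ 2
    + 8 * (g0 ^ 4 + 4 * g0 ^ 2 * gp * gm + gp ^ 2 * gm ^ 2) * b ^ 4
    - 24 * a * b * g0 * (gp + gm) *
      ((2 * g0 ^ 2 + gp ^ 2 + gm ^ 2) * a ^ 2 + 2 * (g0 ^ 2 + gp * gm) * b ^ 2)

/-- `q₁(τ)` for the autocorrelation function `C` and the embedding step `δ`. -/
def q₁ (C : ℤ → ℝ) (δ τ : ℕ) : ℝ :=
  q₁Poly (C 0) (C 1) (gammaCoeff C δ (-1) τ) (gammaCoeff C δ 0 τ) (gammaCoeff C δ 1 τ)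

/-- `q₂(τ)` for the autocorrelation function `C` and the embedding step `δ`. -/
def q₂ (C : ℤ → ℝ) (δ τ : ℕ) : ℝ :=
  q₂Poly (C 0) (C 1) (gammaCoeff C δ (-1) τ) (gammaCoeff C δ 0 τ) (gammaCoeff C δ 1 τ)

end

/-! The kurtosis is invariant under invertible linear changes of coordinates, so `x(n)` may be
replaced by the normalised sum and difference `(u, v)` of its coordinates. These are uncorrelated
with unit variance at each time, because both coordinates of `x(n)` have the same variance. The
kurtosis `B` becomes an explicit rational function of the sample moments of `(u, v)` of orders two
and four (`mardiaKurtosis_eq_planarKurtosis`).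

Express these moments through time averages `D` and `A` of Hermite (Wick) polynomials of degrees two
and four. The terms linear in `D` cancel, and `B = 8 + T - q + m + remainder` with `T` linear in
`A`, `q` quadratic in `D` and `m` bilinear in `D` and `A` (`exists_mardiaKurtosis_expansion`).
Hermite polynomials of different degrees are orthogonal even between correlated Gaussians, so `T`
and `m` are centred. To order `1/N` the mean is therefore `8 - E q` and the variance is `E T²`.
Wick's formula (`integral_wick_pair`) turns both into lag sums of second and fourth powers of
correlations, and algebra identifies these with `q₁` and `q₂` (`sum_quad_dirCov`,
`sum_trace_dirCov`). Polarisation along five directions reduces all of this to powers of scalar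
Gaussian processes.

For the remainder, mixing gives `E D^(2m) = O(N^(-m))` for every `m`, through exponential moments of
Gaussian quadratic forms, together with `E A² = O(1/N)` and `E A⁴ = O(1)`. Where `D` is not small
the expansion is replaced by the deterministic bound `0 ≤ B ≤ 4N`, which costs only `N * D^6`, of
mean `O(N^(-2))`. The resulting errors are `O(N^(-3/2))` for the mean and `O(N^(-5/4))` for the
variance. -/

/-! ### Moments of a centred real Gaussian -/

lemma integral_pow_add_two_gaussianReal (v : NNReal) (n : ℕ) :
    ∫ x, x ^ (n + 2) ∂gaussianReal 0 v = v * (n + 1) * ∫ x, x ^ n ∂gaussianReal 0 v := by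
  by_cases hv : v = 0
  · simp [hv]
  have hv' : (v : ℝ) ≠ 0 := by simpa using hv
  have hI : ∀ m : ℕ, Integrable (fun x : ℝ => x ^ m * gaussianPDFReal 0 v x) := by
    intro m
    have h : Integrable (fun x : ℝ => x ^ m) (gaussianReal 0 v) := by
      have := (memLp_id_gaussianReal' (μ := 0) (v := v) m (by simp)).integrable_norm_pow'
      refine (integrable_norm_iff (by fun_prop)).1 ?_
      simpa using this
    rw [gaussianReal_of_var_ne_zero _ hv, integrable_withDensity_iff (by fun_prop)
      (by simp [gaussianPDF])] at h
    simpa using h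
  have hd : ∀ x : ℝ, HasDerivAt (gaussianPDFReal 0 v) (-(x / v) * gaussianPDFReal 0 v x) x := by
    intro x
    have h1 : HasDerivAt (fun x : ℝ => -(x - 0) ^ 2 / (2 * v)) (-(x / v)) x := by
      have := (((hasDerivAt_id x).sub_const 0).pow 2).neg.div_const (2 * (v : ℝ))
      refine this.congr_deriv ?_
      simp; field_simp
    have := (h1.exp).const_mul (√(2 * Real.pi * v))⁻¹
    rw [gaussianPDFReal_def]
    refine this.congr_deriv ?_
    simp only; ring
  rw [integral_gaussianReal_eq_integral_smul hv, integral_gaussianReal_eq_integral_smul hv]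
  -- Gaussian integration by parts: the density `φ` satisfies `φ' = -(x / v) φ`.
  have key := integral_mul_deriv_eq_deriv_mul_of_integrable (u := fun x : ℝ => x ^ (n + 1))
    (u' := fun x => ((n + 1 : ℕ) : ℝ) * x ^ n) (v := gaussianPDFReal 0 v)
    (v' := fun x => -(x / v) * gaussianPDFReal 0 v x)
    (fun x _ => by simpa using hasDerivAt_pow (n + 1) x) (fun x _ => hd x)
    (by
      refine ((hI (n + 2)).const_mul (-(1 / (v : ℝ)))).congr (ae_of_all _ fun x => ?_)
      simp only [Pi.mul_apply]; field_simp; try ring)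
    (by
      refine ((hI n).const_mul ((n + 1 : ℕ) : ℝ)).congr (ae_of_all _ fun x => ?_)
      simp only [Pi.mul_apply]; ring)
    (by exact hI (n + 1))
  have e1 : ∫ x : ℝ, x ^ (n + 1) * (-(x / v) * gaussianPDFReal 0 v x)
      = -(1 / (v : ℝ)) * ∫ x, gaussianPDFReal 0 v x • x ^ (n + 2) := by
    rw [← integral_const_mul]
    congr 1; ext x; simp only [smul_eq_mul]; field_simp; try ring
  have e2 : ∫ x : ℝ, ((n + 1 : ℕ) : ℝ) * x ^ n * gaussianPDFReal 0 v x
      = (n + 1) * ∫ x, gaussianPDFReal 0 v x • x ^ n := by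
    rw [← integral_const_mul]
    congr 1; ext x; simp only [smul_eq_mul]; push_cast; ring
  rw [e1, e2] at key
  field_simp at key
  linarith

lemma integral_pow_gaussianReal_values (v : NNReal) :
    ∫ x, x ^ 0 ∂gaussianReal 0 v = 1 ∧ ∫ x, x ^ 1 ∂gaussianReal 0 v = 0 ∧
    ∫ x, x ^ 2 ∂gaussianReal 0 v = v ∧ ∫ x, x ^ 3 ∂gaussianReal 0 v = 0 ∧
    ∫ x, x ^ 4 ∂gaussianReal 0 v = 3 * v ^ 2 ∧ ∫ x, x ^ 5 ∂gaussianReal 0 v = 0 ∧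
    ∫ x, x ^ 6 ∂gaussianReal 0 v = 15 * v ^ 3 ∧ ∫ x, x ^ 7 ∂gaussianReal 0 v = 0 ∧
    ∫ x, x ^ 8 ∂gaussianReal 0 v = 105 * v ^ 4 := by
  have h := integral_pow_add_two_gaussianReal v
  have h0 : ∫ x, x ^ 0 ∂gaussianReal 0 v = 1 := by simp
  have h1 : ∫ x, x ^ 1 ∂gaussianReal 0 v = 0 := by simp
  have h2 := h 0
  have h3 := h 1
  have h4 := h 2
  have h5 := h 3
  have h6 := h 4
  have h7 := h 5
  have h8 := h 6
  norm_num only [zero_add, Nat.reduceAdd] at h2 h3 h4 h5 h6 h7 h8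
  rw [h0] at h2
  rw [h1] at h3
  rw [h2] at h4
  rw [h3] at h5
  rw [h4] at h6
  rw [h5] at h7
  rw [h6] at h8
  exact ⟨h0, h1, h2.trans (by ring), h3.trans (by ring), h4.trans (by ring), h5.trans (by ring),
    h6.trans (by ring), h7.trans (by ring), h8.trans (by ring)⟩

/-- The second Hermite polynomial of a centred variable of variance `s`. -/
def wickSq (s x : ℝ) : ℝ := x ^ 2 - s

/-- The fourth Hermite polynomial of a centred variable of variance `s`. -/
def wickFourth (s x : ℝ) : ℝ := x ^ 4 - 6 * s * x ^ 2 + 3 * s ^ 2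

lemma integrable_pow_gaussianReal (v : NNReal) (n : ℕ) :
    Integrable (fun x : ℝ => x ^ n) (gaussianReal 0 v) := by
  have := (memLp_id_gaussianReal' (μ := 0) (v := v) n (by simp)).integrable_norm_pow'
  refine (integrable_norm_iff (by fun_prop)).1 ?_
  simpa using this

/-- Degree eight is what the product of two fourth Hermite polynomials requires. -/
lemma integral_polynomial_gaussianReal (v : NNReal) (c : Fin 9 → ℝ) :
    ∫ x, ∑ i : Fin 9, c i * x ^ (i : ℕ) ∂gaussianReal 0 v
      = c 0 + c 2 * v + 3 * c 4 * v ^ 2 + 15 * c 6 * v ^ 3 + 105 * c 8 * v ^ 4 := by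
  rw [integral_finsetSum _ fun (i : Fin 9) _ => (integrable_pow_gaussianReal v i).const_mul (c i)]
  obtain ⟨h0, h1, h2, h3, h4, h5, h6, h7, h8⟩ := integral_pow_gaussianReal_values v
  simp_rw [integral_const_mul]
  simp only [Fin.sum_univ_succ, Fin.sum_univ_zero]
  change c 0 * (∫ x, x ^ 0 ∂gaussianReal 0 v) + (c 1 * (∫ x, x ^ 1 ∂gaussianReal 0 v)
    + (c 2 * (∫ x, x ^ 2 ∂gaussianReal 0 v) + (c 3 * (∫ x, x ^ 3 ∂gaussianReal 0 v)
    + (c 4 * (∫ x, x ^ 4 ∂gaussianReal 0 v) + (c 5 * (∫ x, x ^ 5 ∂gaussianReal 0 v)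
    + (c 6 * (∫ x, x ^ 6 ∂gaussianReal 0 v) + (c 7 * (∫ x, x ^ 7 ∂gaussianReal 0 v)
    + (c 8 * (∫ x, x ^ 8 ∂gaussianReal 0 v) + 0)))))))) = _
  rw [h0, h1, h2, h3, h4, h5, h6, h7, h8]
  ring

/-! ### Stability of finiteness of moments under algebraic operations -/

/-- Functions all of whose moments are finite. -/
def HasAllMoments {Ω : Type*} [MeasurableSpace Ω] (f : Ω → ℝ) (μ : Measure Ω) : Prop :=
  ∀ p : ℕ, MemLp f p μ

namespace HasAllMoments

variable {Ω : Type*} [MeasurableSpace Ω] {μ : Measure Ω} {f g : Ω → ℝ}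

lemma add (hf : HasAllMoments f μ) (hg : HasAllMoments g μ) :
    HasAllMoments (fun ω => f ω + g ω) μ := fun p => (hf p).add (hg p)

lemma sub (hf : HasAllMoments f μ) (hg : HasAllMoments g μ) :
    HasAllMoments (fun ω => f ω - g ω) μ := fun p => (hf p).sub (hg p)

lemma const_mul (hf : HasAllMoments f μ) (c : ℝ) :
    HasAllMoments (fun ω => c * f ω) μ := fun p => (hf p).const_mul c

lemma abs (hf : HasAllMoments f μ) : HasAllMoments (fun ω => |f ω|) μ := fun p => (hf p).abs

lemma const [IsFiniteMeasure μ] (c : ℝ) : HasAllMoments (fun _ => c) μ := fun _ => memLp_const c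

lemma mul (hf : HasAllMoments f μ) (hg : HasAllMoments g μ) :
    HasAllMoments (fun ω => f ω * g ω) μ := fun p => by
  have : ENNReal.HolderTriple ((2 * p : ℕ) : ENNReal) ((2 * p : ℕ) : ENNReal) p := ⟨by
    push_cast
    rw [ENNReal.mul_inv (by simp) (by simp), ← add_mul, ENNReal.inv_two_add_inv_two, one_mul]⟩
  exact (hg (2 * p)).mul (hf (2 * p))

lemma pow [IsFiniteMeasure μ] (hf : HasAllMoments f μ) (n : ℕ) :
    HasAllMoments (fun ω => f ω ^ n) μ := by
  induction n with
  | zero => simpa using const (μ := μ) 1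
  | succ n ih => simpa [pow_succ] using ih.mul hf

lemma sum {ι : Type*} (s : Finset ι) {f : ι → Ω → ℝ} (hf : ∀ i ∈ s, HasAllMoments (f i) μ) :
    HasAllMoments (fun ω => ∑ i ∈ s, f i ω) μ := fun p =>
  memLp_finsetSum s fun i hi => hf i hi p

lemma integrable (hf : HasAllMoments f μ) : Integrable f μ := by
  simpa [memLp_one_iff_integrable] using hf 1

lemma memLp_two (hf : HasAllMoments f μ) : MemLp f 2 μ := by simpa using hf 2

end HasAllMoments

lemma ProbabilityTheory.HasGaussianLaw.hasAllMoments {Ω : Type*} [MeasurableSpace Ω] {μ : Measure Ω}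
    {X : Ω → ℝ} (hX : HasGaussianLaw X μ) : HasAllMoments X μ := fun p => hX.memLp (by simp)

/-! ### Wick's formula for two jointly Gaussian variables -/

section Pair

variable {Ω : Type*} [MeasurableSpace Ω] {μ : Measure Ω} [IsProbabilityMeasure μ] {X Y : Ω → ℝ}

lemma HasAllMoments.wickSq (hX : HasAllMoments X μ) (s : ℝ) :
    HasAllMoments (fun ω => wickSq s (X ω)) μ := (hX.pow 2).sub (.const s)

lemma HasAllMoments.wickFourth (hX : HasAllMoments X μ) (s : ℝ) :
    HasAllMoments (fun ω => wickFourth s (X ω)) μ :=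
  ((hX.pow 4).sub ((hX.pow 2).const_mul (6 * s))).add (.const _)

omit [IsProbabilityMeasure μ] in
/-- A centred Gaussian variable has law `gaussianReal 0 (E X²)`. -/
lemma map_eq_gaussianReal_of_centred (hX : HasGaussianLaw X μ) (h0 : ∫ ω, X ω ∂μ = 0) :
    μ.map X = gaussianReal 0 (∫ ω, X ω ^ 2 ∂μ).toNNReal := by
  rw [hX.map_eq_gaussianReal, variance_of_integral_eq_zero hX.aemeasurable h0, h0]

omit [IsProbabilityMeasure μ] in
lemma integral_polynomial_gaussian (hX : HasGaussianLaw X μ) (h0 : ∫ ω, X ω ∂μ = 0) {s : ℝ}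
    (hs : ∫ ω, X ω ^ 2 ∂μ = s) (c : Fin 9 → ℝ) :
    ∫ ω, ∑ i : Fin 9, c i * X ω ^ (i : ℕ) ∂μ
      = c 0 + c 2 * s + 3 * c 4 * s ^ 2 + 15 * c 6 * s ^ 3 + 105 * c 8 * s ^ 4 := by
  have hs0 : 0 ≤ s := hs ▸ integral_nonneg fun ω => sq_nonneg _
  have := integral_map (μ := μ) (φ := X) hX.aemeasurable
    (f := fun x : ℝ => ∑ i : Fin 9, c i * x ^ (i : ℕ)) (by fun_prop)
  rw [← this, map_eq_gaussianReal_of_centred hX h0, hs, integral_polynomial_gaussianReal,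
    Real.coe_toNNReal _ hs0]

omit [IsProbabilityMeasure μ] in
-- Each integrand is a polynomial in `X`, and the vectors below list its coefficients by increasing
-- degree. The cubic is the third Hermite polynomial, which occurs when a fourth one is expanded in
-- `integral_wick_pair`.
lemma integral_wick_self (hX : HasGaussianLaw X μ) (h0 : ∫ ω, X ω ∂μ = 0) {s : ℝ}
    (hs : ∫ ω, X ω ^ 2 ∂μ = s) :
    ∫ ω, wickSq s (X ω) * wickSq s (X ω) ∂μ = 2 * s ^ 2 ∧
    ∫ ω, wickSq s (X ω) * wickFourth s (X ω) ∂μ = 0 ∧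
    ∫ ω, wickFourth s (X ω) * wickFourth s (X ω) ∂μ = 24 * s ^ 4 ∧
    ∫ ω, wickSq s (X ω) ∂μ = 0 ∧ ∫ ω, X ω ^ 3 - 3 * s * X ω ∂μ = 0 ∧
    ∫ ω, wickFourth s (X ω) ∂μ = 0 := by
  have key := fun c => integral_polynomial_gaussian hX h0 hs c
  refine ⟨?_, ?_, ?_, ?_, ?_, ?_⟩
  · refine (integral_congr_ae (ae_of_all _ fun ω => ?_)).trans ((key ![s ^ 2, 0, -2 * s, 0, 1, 0, 0, 0, 0]).trans ?_)
    · simp [Fin.sum_univ_succ, wickSq]; ring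
    · simp; ring
  · refine (integral_congr_ae (ae_of_all _ fun ω => ?_)).trans ((key ![-3 * s ^ 3, 0, 9 * s ^ 2, 0, -7 * s, 0, 1, 0, 0]).trans ?_)
    · simp [Fin.sum_univ_succ, wickSq, wickFourth]; ring
    · simp; ring
  · refine (integral_congr_ae (ae_of_all _ fun ω => ?_)).trans ((key ![9 * s ^ 4, 0, -36 * s ^ 3, 0, 42 * s ^ 2, 0, -12 * s, 0, 1]).trans ?_)
    · simp [Fin.sum_univ_succ, wickFourth]; ring
    · simp; ring
  · refine (integral_congr_ae (ae_of_all _ fun ω => ?_)).trans ((key ![-s, 0, 1, 0, 0, 0, 0, 0, 0]).trans ?_)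
    · simp [Fin.sum_univ_succ, wickSq]; ring
    · simp
  · refine (integral_congr_ae (ae_of_all _ fun ω => ?_)).trans ((key ![0, -3 * s, 0, 1, 0, 0, 0, 0, 0]).trans ?_)
    · simp [Fin.sum_univ_succ]; ring
    · simp
  · refine (integral_congr_ae (ae_of_all _ fun ω => ?_)).trans ((key ![3 * s ^ 2, 0, -6 * s, 0, 1, 0, 0, 0, 0]).trans ?_)
    · simp [Fin.sum_univ_succ, wickFourth]; ring
    · simp; ring

/-- Wick's formula for squares and fourth powers of two jointly Gaussian variables. -/
lemma integral_wick_pair (hXY : HasGaussianLaw (fun ω => (X ω, Y ω)) μ)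
    (hX0 : ∫ ω, X ω ∂μ = 0) (hY0 : ∫ ω, Y ω ∂μ = 0) {s t r : ℝ}
    (hs : ∫ ω, X ω ^ 2 ∂μ = s) (ht : ∫ ω, Y ω ^ 2 ∂μ = t) (hr : ∫ ω, X ω * Y ω ∂μ = r)
    (hs0 : s ≠ 0) :
    ∫ ω, wickSq s (X ω) * wickSq t (Y ω) ∂μ = 2 * r ^ 2 ∧
    ∫ ω, wickSq s (X ω) * wickFourth t (Y ω) ∂μ = 0 ∧
    ∫ ω, wickFourth s (X ω) * wickFourth t (Y ω) ∂μ = 24 * r ^ 4 := by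
  have hX := hXY.fst
  have hY := hXY.snd
  have mX := hX.hasAllMoments
  have mY := hY.hasAllMoments
  -- Regression of `Y` on `X`: the residual `Z = Y - c X` is uncorrelated with `X`, hence
  -- independent of it by joint Gaussianity.
  obtain ⟨c, hc⟩ : ∃ c, r = c * s := ⟨r / s, by field_simp⟩
  set Z : Ω → ℝ := fun ω => Y ω - c * X ω with hZdef
  have hXZ : HasGaussianLaw (fun ω => (X ω, Z ω)) μ := by
    have := hXY.map_fun ((ContinuousLinearMap.fst ℝ ℝ ℝ).prod
      (ContinuousLinearMap.snd ℝ ℝ ℝ - c • ContinuousLinearMap.fst ℝ ℝ ℝ))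
    simpa using this
  have hZ := hXZ.snd
  have mZ := hZ.hasAllMoments
  have hZ0 : ∫ ω, Z ω ∂μ = 0 := by
    simp only [hZdef]
    rw [integral_sub mY.integrable (mX.const_mul c).integrable, integral_const_mul, hX0, hY0]
    simp
  have hXZ0 : ∫ ω, X ω * Z ω ∂μ = 0 := by
    have : ∀ ω, X ω * Z ω = X ω * Y ω - c * X ω ^ 2 := fun ω => by simp only [hZdef]; ring
    simp_rw [this]
    rw [integral_sub (mX.mul mY).integrable ((mX.pow 2).const_mul c).integrable,
      integral_const_mul, hs, hr, hc]
    ring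
  have hZ2 : ∫ ω, Z ω ^ 2 ∂μ = t - c ^ 2 * s := by
    have : ∀ ω, Z ω ^ 2 = Y ω ^ 2 - (2 * c) * (X ω * Y ω) + c ^ 2 * X ω ^ 2 :=
      fun ω => by simp only [hZdef]; ring
    simp_rw [this]
    rw [integral_add ((mY.pow 2).sub ((mX.mul mY).const_mul _)).integrable
        ((mX.pow 2).const_mul _).integrable,
      integral_sub (mY.pow 2).integrable ((mX.mul mY).const_mul _).integrable,
      integral_const_mul, integral_const_mul, hs, ht, hr, hc]
    ring
  have hind : IndepFun X Z μ := by
    refine hXZ.indepFun_of_covariance_eq_zero ?_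
    rw [covariance_eq_sub mX.memLp_two mZ.memLp_two]
    simp [hX0, hXZ0]
  have hprod : ∀ p q : ℝ → ℝ, Continuous p → Continuous q →
      ∫ ω, p (X ω) * q (Z ω) ∂μ = (∫ ω, p (X ω) ∂μ) * ∫ ω, q (Z ω) ∂μ := fun p q hp hq =>
    hind.integral_fun_comp_mul_comp hX.aemeasurable hZ.aemeasurable
      hp.aestronglyMeasurable hq.aestronglyMeasurable
  obtain ⟨x22, x24, x44, -, -, -⟩ := integral_wick_self hX hX0 hs
  obtain ⟨-, -, -, z2, z3, z4⟩ := integral_wick_self hZ hZ0 hZ2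
  set w := t - c ^ 2 * s with hw
  have ht' : t = w + c ^ 2 * s := by rw [hw]; ring
  have cSq : ∀ a, Continuous (wickSq a) := fun a => by unfold wickSq; fun_prop
  have cFo : ∀ a, Continuous (wickFourth a) := fun a => by unfold wickFourth; fun_prop
  -- Addition formula for Hermite polynomials: for `t = c² s + w`, the polynomial of `c X + Z` is a
  -- binomial sum of products of Hermite polynomials of `X` and of `Z`. Every term with a
  -- nonconstant factor in `Z` integrates to zero by independence. The same argument gives `fo`.
  have sq : ∀ p : ℝ → ℝ, Continuous p → HasAllMoments (fun ω => p (X ω)) μ →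
      ∫ ω, p (X ω) * wickSq t (Y ω) ∂μ = c ^ 2 * ∫ ω, p (X ω) * wickSq s (X ω) ∂μ := by
    intro p hp mp
    have e : ∀ ω, p (X ω) * wickSq t (Y ω) = c ^ 2 * (p (X ω) * wickSq s (X ω))
        + (2 * c) * ((p (X ω) * X ω) * Z ω) + p (X ω) * wickSq w (Z ω) := fun ω => by
      have : Y ω = Z ω + c * X ω := by simp only [hZdef]; ring
      rw [this, ht']; simp only [wickSq]; ring
    have m1 := (mp.mul (mX.wickSq s)).const_mul (c ^ 2)
    have m2 := ((mp.mul mX).mul mZ).const_mul (2 * c)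
    have m3 := mp.mul (mZ.wickSq w)
    simp_rw [e]
    rw [integral_add (m1.add m2).integrable m3.integrable, integral_add m1.integrable m2.integrable,
      integral_const_mul, integral_const_mul, hprod (fun x => p x * x) (fun z => z) (by fun_prop)
      (by fun_prop), hprod p _ hp (cSq w), hZ0, z2]
    ring
  have fo : ∀ p : ℝ → ℝ, Continuous p → HasAllMoments (fun ω => p (X ω)) μ →
      ∫ ω, p (X ω) * wickFourth t (Y ω) ∂μ = c ^ 4 * ∫ ω, p (X ω) * wickFourth s (X ω) ∂μ := by
    intro p hp mp
    have e : ∀ ω, p (X ω) * wickFourth t (Y ω) = c ^ 4 * (p (X ω) * wickFourth s (X ω))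
        + (4 * c ^ 3) * ((p (X ω) * (X ω ^ 3 - 3 * s * X ω)) * Z ω)
        + (6 * c ^ 2) * ((p (X ω) * wickSq s (X ω)) * wickSq w (Z ω))
        + (4 * c) * ((p (X ω) * X ω) * (Z ω ^ 3 - 3 * w * Z ω))
        + p (X ω) * wickFourth w (Z ω) := fun ω => by
      have : Y ω = Z ω + c * X ω := by simp only [hZdef]; ring
      rw [this, ht']; simp only [wickSq, wickFourth]; ring
    have m1 := (mp.mul (mX.wickFourth s)).const_mul (c ^ 4)
    have m2 := ((mp.mul ((mX.pow 3).sub (mX.const_mul (3 * s)))).mul mZ).const_mul (4 * c ^ 3)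
    have m3 := ((mp.mul (mX.wickSq s)).mul (mZ.wickSq w)).const_mul (6 * c ^ 2)
    have m4 := ((mp.mul mX).mul ((mZ.pow 3).sub (mZ.const_mul (3 * w)))).const_mul (4 * c)
    have m5 := mp.mul (mZ.wickFourth w)
    simp_rw [e]
    rw [integral_add (((m1.add m2).add m3).add m4).integrable m5.integrable,
      integral_add ((m1.add m2).add m3).integrable m4.integrable,
      integral_add (m1.add m2).integrable m3.integrable, integral_add m1.integrable m2.integrable,
      integral_const_mul, integral_const_mul, integral_const_mul, integral_const_mul,
      hprod (fun x => p x * (x ^ 3 - 3 * s * x)) (fun z => z) (by fun_prop) (by fun_prop),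
      hprod (fun x => p x * wickSq s x) (wickSq w) (hp.mul (cSq s)) (cSq w),
      hprod (fun x => p x * x) (fun z => z ^ 3 - 3 * w * z) (by fun_prop) (by fun_prop),
      hprod p _ hp (cFo w), hZ0, z2, z3, z4]
    ring
  refine ⟨?_, ?_, ?_⟩
  · rw [sq _ (cSq s) (mX.wickSq s), x22, hc]; ring
  · rw [fo _ (cSq s) (mX.wickSq s), x24]; ring
  · rw [fo _ (cFo s) (mX.wickFourth s), x44, hc]; ring

end Pair

/-! ### Exponential and even moments of centred Gaussian quadratic forms -/

section QuadraticForm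

/-- The linear term `y / 2` is sharp: with `y = 2 t s` it cancels the centring factor `exp (-(t s))`
exactly, leaving a quadratic exponent in `mgf_sq_gaussian_le`. -/
lemma inv_sqrt_one_sub_le_exp {y : ℝ} (hy : y ≤ 1 / 2) :
    (√(1 - y))⁻¹ ≤ Real.exp (y / 2 + y ^ 2) := by
  have h1 : 0 < 1 - y := by linarith
  have h2 : (1 - y)⁻¹ ≤ Real.exp (y + 2 * y ^ 2) := by
    calc (1 - y)⁻¹ = y / (1 - y) + 1 := by field_simp; ring
      _ ≤ (y + 2 * y ^ 2) + 1 := by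
        gcongr
        rw [div_le_iff₀ h1]
        nlinarith [sq_nonneg y, mul_nonneg (sq_nonneg y) (by linarith : (0 : ℝ) ≤ 1 - 2 * y)]
      _ ≤ _ := Real.add_one_le_exp _
  rw [← Real.sqrt_inv]
  refine Real.sqrt_le_iff.2 ⟨(Real.exp_pos _).le, ?_⟩
  rw [← Real.exp_nat_mul]
  refine h2.trans_eq ?_
  congr 1; push_cast; ring

variable {Ω : Type*} [MeasurableSpace Ω] {μ : Measure Ω} [IsProbabilityMeasure μ]

lemma mgf_sq_gaussianReal {v : NNReal} {t : ℝ} (h : t * v ≤ 1 / 4) :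
    ∫ x, Real.exp (t * (x ^ 2 - v)) ∂gaussianReal 0 v
      = Real.exp (-(t * v)) * (√(1 - 2 * (t * v)))⁻¹ := by
  by_cases hv : v = 0
  · simp [hv]
  have hv' : (0 : ℝ) < v := by positivity
  rw [integral_gaussianReal_eq_integral_smul hv]
  have e : ∀ x : ℝ, gaussianPDFReal 0 v x • Real.exp (t * (x ^ 2 - v))
      = ((√(2 * Real.pi * v))⁻¹ * Real.exp (-(t * v))) *
        Real.exp (-(1 / (2 * v) - t) * x ^ 2) := fun x => by
    rw [gaussianPDFReal, smul_eq_mul, mul_assoc (√_)⁻¹, mul_assoc (√_)⁻¹, ← Real.exp_add,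
      ← Real.exp_add]
    congr 2; field_simp; ring
  simp_rw [e]
  rw [integral_const_mul, integral_gaussian, mul_comm (√(2 * Real.pi * v))⁻¹, mul_assoc]
  congr 1
  rw [← Real.sqrt_inv, ← Real.sqrt_inv, ← Real.sqrt_mul (by positivity)]
  congr 1
  have : 1 - 2 * (t * v) ≠ 0 := by linarith
  have h3 : 1 / (2 * (v : ℝ)) - t = (1 - 2 * (t * v)) / (2 * v) := by field_simp
  rw [h3]
  field_simp

omit [IsProbabilityMeasure μ] in
lemma mgf_sq_gaussian_le {X : Ω → ℝ} (hX : HasGaussianLaw X μ) (h0 : ∫ ω, X ω ∂μ = 0) {s t : ℝ}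
    (hs : ∫ ω, X ω ^ 2 ∂μ = s) (h : t * s ≤ 1 / 4) :
    0 < mgf (fun ω => X ω ^ 2 - s) μ t ∧
    mgf (fun ω => X ω ^ 2 - s) μ t ≤ Real.exp (4 * t ^ 2 * s ^ 2) := by
  have hs0 : 0 ≤ s := hs ▸ integral_nonneg fun ω => sq_nonneg _
  have e : mgf (fun ω => X ω ^ 2 - s) μ t = Real.exp (-(t * s)) * (√(1 - 2 * (t * s)))⁻¹ := by
    have := integral_map (μ := μ) (φ := X) hX.aemeasurable
      (f := fun x : ℝ => Real.exp (t * (x ^ 2 - s))) (by fun_prop)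
    rw [mgf, ← this, map_eq_gaussianReal_of_centred hX h0, hs]
    have hc := Real.coe_toNNReal _ hs0
    have := mgf_sq_gaussianReal (v := s.toNNReal) (t := t) (by rwa [hc])
    rwa [hc] at this
  rw [e]
  have : 0 < 1 - 2 * (t * s) := by linarith
  refine ⟨by positivity, ?_⟩
  calc _ ≤ Real.exp (-(t * s)) * Real.exp ((2 * (t * s)) / 2 + (2 * (t * s)) ^ 2) := by
        gcongr
        exact inv_sqrt_one_sub_le_exp (by linarith)
    _ = _ := by rw [← Real.exp_add]; congr 1; ring

variable {ι : Type*} [Fintype ι] {X : ι → Ω → ℝ}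

/-- Exponential moments of the centred squared norm of a Gaussian vector, by diagonalisation of
its covariance matrix. -/
lemma mgf_sum_sq_gaussian_le (hX : HasGaussianLaw (fun ω i => X i ω) μ)
    (h0 : ∀ i, ∫ ω, X i ω ∂μ = 0) {K : ι → ι → ℝ} (hK : ∀ i j, ∫ ω, X i ω * X j ω ∂μ = K i j)
    {t : ℝ} (ht : 16 * t ^ 2 * ∑ i, ∑ j, K i j ^ 2 ≤ 1) :
    Integrable (fun ω => Real.exp (t * ∑ i, (X i ω ^ 2 - K i i))) μ ∧
    ∫ ω, Real.exp (t * ∑ i, (X i ω ^ 2 - K i i)) ∂μ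
      ≤ Real.exp (4 * t ^ 2 * ∑ i, ∑ j, K i j ^ 2) := by
  classical
  have mX : ∀ i, HasAllMoments (X i) μ := fun i => (hX.eval i).hasAllMoments
  set A : Matrix ι ι ℝ := Matrix.of K with hA
  have hsymm : A.IsHermitian := by
    ext i j
    simp only [hA, Matrix.conjTranspose_apply, Matrix.of_apply, star_trivial, ← hK]
    congr 1; ext ω; ring
  set b := hsymm.eigenvectorBasis with hb
  set l := hsymm.eigenvalues with hl
  have hAb : ∀ j i, ∑ k, K i k * b j k = l j * b j i := fun j i => by
    have := congrFun (hsymm.mulVec_eigenvectorBasis j) i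
    simpa [Matrix.mulVec, dotProduct, hA] using this
  have hbb : ∀ j k, ∑ i, b j i * b k i = if j = k then 1 else 0 := fun j k => by
    have := orthonormal_iff_ite.1 b.orthonormal k j
    simp only [PiLp.inner_apply, RCLike.inner_apply, conj_trivial] at this
    rw [this]; simp [eq_comm]
  have parseval : ∀ x : ι → ℝ, ∑ j, (∑ i, b j i * x i) ^ 2 = ∑ i, x i ^ 2 := fun x => by
    have := b.sum_sq_norm_inner_right (WithLp.toLp 2 x)
    simp only [PiLp.inner_apply, RCLike.inner_apply, conj_trivial, EuclideanSpace.norm_sq_eq,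
      Real.norm_eq_abs, sq_abs] at this
    rw [← this]
    simp_rw [mul_comm]
  set ζ : ι → Ω → ℝ := fun j ω => ∑ i, b j i * X i ω with hζ
  have hζG : HasGaussianLaw (fun ω j => ζ j ω) μ := by
    have := hX.map_fun (ContinuousLinearMap.pi fun j : ι =>
      ∑ i, b j i • (ContinuousLinearMap.proj (R := ℝ) (φ := fun _ : ι => ℝ) i))
    simpa [hζ] using this
  have mζ : ∀ j, HasAllMoments (ζ j) μ := fun j => (hζG.eval j).hasAllMoments
  have ζ0 : ∀ j, ∫ ω, ζ j ω ∂μ = 0 := fun j => by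
    simp only [hζ]
    rw [integral_finsetSum _ fun i _ => ((mX i).const_mul (b j i)).integrable]
    simp [integral_const_mul, h0]
  have ζζ : ∀ j k, ∫ ω, ζ j ω * ζ k ω ∂μ = if j = k then l j else 0 := fun j k => by
    have e : ∀ ω, ζ j ω * ζ k ω = ∑ i, ∑ i', (b k i * b j i') * (X i ω * X i' ω) := fun ω => by
      simp only [hζ]
      rw [mul_comm, Finset.sum_mul_sum]
      refine Finset.sum_congr rfl fun i _ => Finset.sum_congr rfl fun i' _ => by ring
    simp_rw [e]
    rw [integral_finsetSum _ fun i _ => (HasAllMoments.sum _ fun i' _ =>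
      ((mX i).mul (mX i')).const_mul _).integrable]
    have : ∀ i, ∫ ω, ∑ i', (b k i * b j i') * (X i ω * X i' ω) ∂μ
        = l j * (b j i * b k i) := fun i => by
      rw [integral_finsetSum _ fun i' _ => (((mX i).mul (mX i')).const_mul _).integrable]
      simp_rw [integral_const_mul, hK]
      rw [← mul_assoc, ← hAb, Finset.sum_mul]
      refine Finset.sum_congr rfl fun i' _ => by ring
    simp_rw [this]
    rw [← Finset.mul_sum, hbb]
    simp
  have hind : iIndepFun ζ μ := hζG.iIndepFun_of_covariance_eq_zero fun j k hjk => by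
    rw [covariance_eq_sub (mζ j).memLp_two (mζ k).memLp_two]
    simp [ζ0, ζζ, hjk]
  have ζ2 : ∀ j, ∫ ω, ζ j ω ^ 2 ∂μ = l j := fun j => by simp_rw [sq, ζζ]; simp
  have hsum : ∀ ω, ∑ j, ζ j ω ^ 2 = ∑ i, X i ω ^ 2 := fun ω => parseval fun i => X i ω
  have htr : ∑ j, l j = ∑ i, K i i := by
    simp_rw [← ζ2, ← hK]
    rw [← integral_finsetSum _ fun j _ => ((mζ j).pow 2).integrable,
      ← integral_finsetSum _ fun i _ => ((mX i).mul (mX i)).integrable]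
    congr 1; ext ω
    rw [hsum]
    simp_rw [sq]
  have hfro : ∑ j, l j ^ 2 = ∑ i, ∑ j, K i j ^ 2 := by
    have h1 : ∀ j, l j ^ 2 = ∑ i, (∑ k, b j k * K i k) ^ 2 := fun j => by
      have : ∀ i, ∑ k, b j k * K i k = l j * b j i := fun i => by
        rw [← hAb]; exact Finset.sum_congr rfl fun k _ => mul_comm _ _
      simp_rw [this, mul_pow, ← Finset.mul_sum, sq (b j _)]
      rw [hbb]; simp
    simp_rw [h1]
    rw [Finset.sum_comm]
    exact Finset.sum_congr rfl fun i _ => parseval (K i)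
  -- The Frobenius norm dominates every eigenvalue, so one condition on `t` serves all factors.
  have hle : ∀ j, t * l j ≤ 1 / 4 := fun j => by
    have h1 : l j ^ 2 ≤ ∑ i, ∑ j, K i j ^ 2 := by
      rw [← hfro]
      exact Finset.single_le_sum (f := fun j => l j ^ 2) (fun _ _ => sq_nonneg _)
        (Finset.mem_univ j)
    have h2 : (t * l j) ^ 2 ≤ (1 / 4) ^ 2 := by
      rw [mul_pow]
      nlinarith [mul_le_mul_of_nonneg_left h1 (sq_nonneg t)]
    exact (abs_le_of_sq_le_sq' h2 (by norm_num)).2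
  have hmgf := fun j => mgf_sq_gaussian_le (hζG.eval j) (ζ0 j) (ζ2 j) (hle j)
  have hind2 : iIndepFun (fun j ω => ζ j ω ^ 2 - l j) μ :=
    hind.comp (fun j x => x ^ 2 - l j) fun j => by fun_prop
  have hm := hind2.mgf_sum₀ (t := t)
    (fun j => ((hζG.eval j).aemeasurable.pow_const 2).sub_const _) Finset.univ
  have hfun : (∑ j, fun ω => ζ j ω ^ 2 - l j) = fun ω => ∑ i, (X i ω ^ 2 - K i i) := by
    ext ω
    rw [Finset.sum_apply, Finset.sum_sub_distrib, Finset.sum_sub_distrib, hsum, htr]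
  rw [hfun] at hm
  constructor
  -- Positivity of the mgf encodes integrability, since the integral of a nonintegrable function is
  -- zero by convention.
  · have : 0 < mgf (fun ω => ∑ i, (X i ω ^ 2 - K i i)) μ t := by
      rw [hm]; exact Finset.prod_pos fun j _ => (hmgf j).1
    exact mgf_pos_iff.1 this
  · change mgf (fun ω => ∑ i, (X i ω ^ 2 - K i i)) μ t ≤ _
    rw [hm, ← hfro, Finset.mul_sum, Real.exp_sum]
    exact Finset.prod_le_prod (fun j _ => (hmgf j).1.le) fun j _ => (hmgf j).2

/-- Even moments of the centred squared norm of a Gaussian vector. -/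
lemma integral_sum_sq_gaussian_pow_le (hX : HasGaussianLaw (fun ω i => X i ω) μ)
    (h0 : ∀ i, ∫ ω, X i ω ∂μ = 0) {K : ι → ι → ℝ} (hK : ∀ i j, ∫ ω, X i ω * X j ω ∂μ = K i j)
    {V : ℝ} (hV : 0 < V) (hKV : ∑ i, ∑ j, K i j ^ 2 ≤ V) (m : ℕ) :
    ∫ ω, (∑ i, (X i ω ^ 2 - K i i)) ^ (2 * m) ∂μ
      ≤ (2 * m).factorial * 16 ^ m * (2 * Real.exp 1) * V ^ m := by
  set S : Ω → ℝ := fun ω => ∑ i, (X i ω ^ 2 - K i i) with hS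
  -- The largest `t` allowed by the mgf bound when only `V` is known. It makes `t^(-2m) = (16 V)^m`,
  -- and the factor `2 * exp 1` bounds the sum of the exponential moments at `t` and `-t`.
  set t : ℝ := (4 * √V)⁻¹ with ht
  have htV : 16 * t ^ 2 * V = 1 := by
    rw [ht, inv_pow, mul_pow, Real.sq_sqrt hV.le]; field_simp; norm_num
  have ht0 : 0 < t := by positivity
  have h1 : 16 * t ^ 2 * ∑ i, ∑ j, K i j ^ 2 ≤ 1 := by rw [← htV]; gcongr
  have hE : 4 * t ^ 2 * ∑ i, ∑ j, K i j ^ 2 ≤ 1 := by nlinarith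
  obtain ⟨i1, b1⟩ := mgf_sum_sq_gaussian_le hX h0 hK (t := t) h1
  obtain ⟨i2, b2⟩ := mgf_sum_sq_gaussian_le hX h0 hK (t := -t) (by simpa using h1)
  have hpt : ∀ ω, S ω ^ (2 * m) ≤ ((2 * m).factorial * 16 ^ m * V ^ m) *
      (Real.exp (t * S ω) + Real.exp (-t * S ω)) := fun ω => by
    have hf : (0 : ℝ) < (2 * m).factorial := by positivity
    have e1 : |t * S ω| ^ (2 * m) / (2 * m).factorial ≤
        Real.exp (t * S ω) + Real.exp (-t * S ω) := by
      refine (Real.pow_div_factorial_le_exp _ (abs_nonneg _) _).trans ?_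
      rcases abs_cases (t * S ω) with ⟨h, -⟩ | ⟨h, -⟩ <;> rw [h]
      · linarith [Real.exp_pos (-t * S ω)]
      · rw [← neg_mul]; linarith [Real.exp_pos (t * S ω)]
    rw [div_le_iff₀ hf, (even_two_mul m).pow_abs, mul_pow] at e1
    have e2 : (16 * V) ^ m * t ^ (2 * m) = 1 := by
      rw [pow_mul, ← mul_pow, show 16 * V * t ^ 2 = 1 by linarith, one_pow]
    calc S ω ^ (2 * m) = (16 * V) ^ m * (t ^ (2 * m) * S ω ^ (2 * m)) := by
          rw [← mul_assoc, e2, one_mul]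
      _ ≤ (16 * V) ^ m * ((Real.exp (t * S ω) + Real.exp (-t * S ω)) * (2 * m).factorial) := by
          gcongr
      _ = _ := by rw [mul_pow]; ring
  calc ∫ ω, S ω ^ (2 * m) ∂μ
      ≤ ∫ ω, ((2 * m).factorial * 16 ^ m * V ^ m) *
        (Real.exp (t * S ω) + Real.exp (-t * S ω)) ∂μ :=
        integral_mono_of_nonneg (ae_of_all _ fun ω => (even_two_mul m).pow_nonneg _)
          ((i1.add i2).const_mul _) (ae_of_all _ hpt)
    _ ≤ ((2 * m).factorial * 16 ^ m * V ^ m) * (2 * Real.exp 1) := by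
        rw [integral_const_mul, integral_add i1 i2]
        gcongr
        have b1' := b1.trans (Real.exp_le_exp.2 hE)
        have b2' := b2.trans (Real.exp_le_exp.2 (by simpa using hE))
        linarith
    _ = _ := by ring

end QuadraticForm

/-! ### Time averages and double averages over lags -/

/-- The average `(1/N) ∑_{n=1}^N f n`. -/
noncomputable def avg (f : ℤ → ℝ) (N : ℕ) : ℝ := (1 / (N : ℝ)) * ∑ n ∈ Finset.Icc 1 N, f n

/-- The double average of a function of the time lag. -/
noncomputable def lagAvg (f : ℤ → ℝ) (N : ℕ) : ℝ :=
  1 / (N : ℝ) ^ 2 * ∑ s ∈ Finset.Icc 1 N, ∑ t ∈ Finset.Icc 1 N, f ((s : ℤ) - t)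

/-- Passing from `N` to `N + 1` adds one row and one column: one more diagonal term and, for each
`τ` from `1` to `N`, one more copy of `f τ` and of `f (-τ)`. -/
lemma sum_sum_lag_eq (f : ℤ → ℝ) (N : ℕ) :
    ∑ s ∈ Finset.Icc 1 N, ∑ t ∈ Finset.Icc 1 N, f ((s : ℤ) - t)
      = N * f 0 + ∑ τ ∈ Finset.Icc 1 (N - 1), ((N : ℝ) - τ) * (f τ + f (-τ)) := by
  induction N with
  | zero => simp
  | succ N ih =>
    have refl : ∀ g : ℕ → ℝ, ∑ s ∈ Finset.Icc 1 N, g s = ∑ s ∈ Finset.Icc 1 N, g (N + 1 - s) := by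
      intro g
      refine Finset.sum_nbij' (fun s => N + 1 - s) (fun s => N + 1 - s) ?_ ?_ ?_ ?_ ?_
      all_goals intro s hs; rw [Finset.mem_Icc] at hs
      · rw [Finset.mem_Icc]; omega
      · rw [Finset.mem_Icc]; omega
      · omega
      · omega
      · congr 1; omega
    have e1 : ∑ s ∈ Finset.Icc 1 N, f ((s : ℤ) - (N + 1 : ℕ))
        = ∑ s ∈ Finset.Icc 1 N, f (-(s : ℤ)) := by
      rw [refl fun s => f ((s : ℤ) - (N + 1 : ℕ))]
      refine Finset.sum_congr rfl fun s hs => ?_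
      rw [Finset.mem_Icc] at hs
      congr 1; push_cast [Nat.cast_sub (show s ≤ N + 1 by omega)]; ring
    have e2 : ∑ s ∈ Finset.Icc 1 N, f (((N + 1 : ℕ) : ℤ) - s)
        = ∑ s ∈ Finset.Icc 1 N, f (s : ℤ) := by
      rw [refl fun s => f (((N + 1 : ℕ) : ℤ) - s)]
      refine Finset.sum_congr rfl fun s hs => ?_
      rw [Finset.mem_Icc] at hs
      congr 1; push_cast [Nat.cast_sub (show s ≤ N + 1 by omega)]; ring
    -- The range may be extended to `τ = N`, where the weight vanishes.
    have e3 : ∑ τ ∈ Finset.Icc 1 (N - 1), ((N : ℝ) - τ) * (f τ + f (-τ))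
        = ∑ τ ∈ Finset.Icc 1 N, ((N : ℝ) - τ) * (f τ + f (-τ)) := by
      rcases N with _ | M
      · simp
      · rw [Finset.sum_Icc_succ_top (by omega)]
        simp
    have hI : 1 ≤ N + 1 := by omega
    simp only [Finset.sum_Icc_succ_top hI, Finset.sum_add_distrib, Nat.add_sub_cancel]
    rw [ih, e1, e2, e3]
    have e4 : ∑ τ ∈ Finset.Icc 1 N, (((N + 1 : ℕ) : ℝ) - τ) * (f τ + f (-τ))
        = ∑ τ ∈ Finset.Icc 1 N, ((N : ℝ) - τ) * (f τ + f (-τ))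
          + (∑ τ ∈ Finset.Icc 1 N, f τ + ∑ τ ∈ Finset.Icc 1 N, f (-τ)) := by
      rw [← Finset.sum_add_distrib, ← Finset.sum_add_distrib]
      refine Finset.sum_congr rfl fun τ _ => ?_
      push_cast; ring
    rw [e4]
    push_cast
    rw [sub_self]
    ring

/-- Each row runs over distinct lags. This is how mixing turns `N²` covariances into a total of
order `N`. -/
lemma sum_sum_lag_le {f : ℤ → ℝ} (hf : Summable f) (h0 : ∀ τ, 0 ≤ f τ) (N : ℕ) :
    ∑ s ∈ Finset.Icc 1 N, ∑ t ∈ Finset.Icc 1 N, f ((s : ℤ) - t) ≤ N * ∑' τ, f τ := by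
  have : ∀ s ∈ Finset.Icc 1 N, ∑ t ∈ Finset.Icc 1 N, f ((s : ℤ) - t) ≤ ∑' τ, f τ := fun s _ => by
    have inj : Function.Injective fun t : ℕ => (s : ℤ) - t := fun a b h => by
      simpa using h
    refine ((hf.comp_injective inj).sum_le_tsum _ fun t _ => h0 _).trans ?_
    exact tsum_comp_le_tsum_of_inj hf h0 inj
  refine (Finset.sum_le_sum this).trans ?_
  simp

/-! ### Averaged Wick powers of stationary Gaussian families -/

section StationaryProcess

variable {Ω : Type*} [MeasurableSpace Ω] {μ : Measure Ω} [IsProbabilityMeasure μ]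

omit [IsProbabilityMeasure μ] in
lemma HasAllMoments.avg {f : ℤ → Ω → ℝ} (hf : ∀ n, HasAllMoments (f n) μ) (N : ℕ) :
    HasAllMoments (fun ω => avg (fun n => f n ω) N) μ :=
  (HasAllMoments.sum (f := fun (n : ℕ) ω => f n ω) _ fun n _ => hf n).const_mul _

omit [IsProbabilityMeasure μ] in
lemma integral_avg_mul_avg {f g : ℤ → Ω → ℝ} (hf : ∀ n, HasAllMoments (f n) μ)
    (hg : ∀ n, HasAllMoments (g n) μ) {c : ℤ → ℝ}
    (hc : ∀ s t, ∫ ω, f s ω * g t ω ∂μ = c (s - t)) (N : ℕ) :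
    ∫ ω, avg (fun n => f n ω) N * avg (fun n => g n ω) N ∂μ = lagAvg c N := by
  have e : ∀ ω, avg (fun n => f n ω) N * avg (fun n => g n ω) N
      = 1 / (N : ℝ) ^ 2 * ∑ s ∈ Finset.Icc 1 N, ∑ t ∈ Finset.Icc 1 N, f s ω * g t ω := fun ω => by
    rw [avg, avg, ← Finset.sum_mul_sum]; ring
  simp_rw [e]
  rw [integral_const_mul, lagAvg, integral_finsetSum _ fun (s : ℕ) _ => (HasAllMoments.sum _
    fun (t : ℕ) _ => (hf s).mul (hg t)).integrable]
  congr 1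
  refine Finset.sum_congr rfl fun s _ => ?_
  rw [integral_finsetSum _ fun (t : ℕ) _ => ((hf s).mul (hg t)).integrable]
  exact Finset.sum_congr rfl fun t _ => hc _ _

lemma avg_pow_four_le (f : ℤ → ℝ) (N : ℕ) : avg f N ^ 4 ≤ avg (fun n => f n ^ 4) N := by
  rcases Nat.eq_zero_or_pos N with rfl | hN
  · simp [avg]
  have := Real.pow_arith_mean_le_arith_mean_pow_of_even (Finset.Icc 1 N)
    (fun _ => 1 / (N : ℝ)) (fun n => f n) (fun _ _ => by positivity)
    (by simp; field_simp) (n := 4) (by decide)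
  simpa [avg, Finset.mul_sum] using this

/-- A family of jointly Gaussian, jointly stationary, centred scalar processes with cross-correlation
functions `r k l`, which are square summable. -/
structure IsStationaryGaussianFamily {κ : Type*} (μ : Measure Ω) (g : κ → ℤ → Ω → ℝ)
    (r : κ → κ → ℤ → ℝ) : Prop where
  gaussian : IsGaussianProcess (fun p : κ × ℤ => g p.1 p.2) μ
  mean : ∀ k n, ∫ ω, g k n ω ∂μ = 0
  cov : ∀ k l s t, ∫ ω, g k s ω * g l t ω ∂μ = r k l (s - t)
  summable : ∀ k l, Summable fun τ => r k l τ ^ 2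
  pos : ∀ k, 0 < r k k 0

namespace IsStationaryGaussianFamily

variable {κ : Type*} {g : κ → ℤ → Ω → ℝ} {r : κ → κ → ℤ → ℝ}

omit [IsProbabilityMeasure μ] in
lemma hasAllMoments (h : IsStationaryGaussianFamily μ g r) (k : κ) (n : ℤ) :
    HasAllMoments (g k n) μ := (h.gaussian.hasGaussianLaw_eval (k, n)).hasAllMoments

omit [IsProbabilityMeasure μ] in
lemma integral_sq (h : IsStationaryGaussianFamily μ g r) (k : κ) (n : ℤ) :
    ∫ ω, g k n ω ^ 2 ∂μ = r k k 0 := by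
  simp_rw [sq, h.cov, sub_self]

lemma integral_avg_wick (h : IsStationaryGaussianFamily μ g r) (k l : κ) (N : ℕ) :
    ∫ ω, avg (fun n => wickSq (r k k 0) (g k n ω)) N * avg (fun n => wickSq (r l l 0) (g l n ω)) N
      ∂μ = lagAvg (fun τ => 2 * r k l τ ^ 2) N ∧
    ∫ ω, avg (fun n => wickSq (r k k 0) (g k n ω)) N
      * avg (fun n => wickFourth (r l l 0) (g l n ω)) N ∂μ = 0 ∧
    ∫ ω, avg (fun n => wickFourth (r k k 0) (g k n ω)) N
      * avg (fun n => wickFourth (r l l 0) (g l n ω)) N ∂μ = lagAvg (fun τ => 24 * r k l τ ^ 4) N := by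
  have key := fun s t : ℤ => integral_wick_pair (h.gaussian.hasGaussianLaw_prodMk (s := (k, s))
    (t := (l, t))) (h.mean k s) (h.mean l t) (h.integral_sq k s) (h.integral_sq l t)
    (h.cov k l s t) (h.pos k).ne'
  have m2 := fun k n => (h.hasAllMoments k n).wickSq (r k k 0)
  have m4 := fun k n => (h.hasAllMoments k n).wickFourth (r k k 0)
  refine ⟨integral_avg_mul_avg (m2 k) (m2 l) (fun s t => (key s t).1) N, ?_,
    integral_avg_mul_avg (m4 k) (m4 l) (c := fun τ => 24 * r k l τ ^ 4)
      (fun s t => (key s t).2.2) N⟩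
  rw [integral_avg_mul_avg (m2 k) (m4 l) (c := fun _ => 0) (fun s t => (key s t).2.1) N]
  simp [lagAvg]

lemma integral_avg_wickFourth (h : IsStationaryGaussianFamily μ g r) (k : κ) (N : ℕ) :
    ∫ ω, avg (fun n => wickFourth (r k k 0) (g k n ω)) N ∂μ = 0 := by
  unfold avg
  rw [integral_const_mul, integral_finsetSum _ fun (n : ℕ) _ =>
    ((h.hasAllMoments k n).wickFourth (r k k 0)).integrable, Finset.sum_eq_zero, mul_zero]
  intro n _
  exact (integral_wick_self (h.gaussian.hasGaussianLaw_eval (k, (n : ℤ))) (h.mean k n)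
    (h.integral_sq k n)).2.2.2.2.2

/-- The average is `1/N` times the centred squared norm of the Gaussian vector of the first `N`
values, whose covariance matrix has squared Frobenius norm at most `N * T`. Using `T + 1` keeps the
parameter `V` positive. -/
lemma exists_integral_avg_wickSq_pow_le (h : IsStationaryGaussianFamily μ g r) (k : κ) (m : ℕ) :
    ∃ K : ℝ, 0 ≤ K ∧ ∀ N : ℕ, 1 ≤ N →
      ∫ ω, avg (fun n => wickSq (r k k 0) (g k n ω)) N ^ (2 * m) ∂μ ≤ K * (1 / (N : ℝ)) ^ m := by
  set T : ℝ := ∑' τ, r k k τ ^ 2 with hT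
  have hT0 : 0 ≤ T := tsum_nonneg fun τ => sq_nonneg _
  refine ⟨(2 * m).factorial * 16 ^ m * (2 * Real.exp 1) * (T + 1) ^ m, by positivity,
    fun N hN => ?_⟩
  have hN0 : (0 : ℝ) < N := by exact_mod_cast hN
  have hG : IsGaussianProcess (fun (n : ℕ) ω => g k n ω) μ :=
    h.gaussian.comp_right fun n : ℕ => (k, (n : ℤ))
  have hb := integral_sum_sq_gaussian_pow_le (X := fun (i : Finset.Icc 1 N) ω => g k (i : ℕ) ω)
    (hG.hasGaussianLaw (Finset.Icc 1 N)) (fun i => h.mean k _)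
    (K := fun i j => r k k (((i : ℕ) : ℤ) - (j : ℕ))) (fun i j => h.cov k k _ _)
    (V := N * (T + 1)) (by positivity) (by
      have := sum_sum_lag_le (h.summable k k) (fun τ => sq_nonneg _) N
      rw [← Finset.sum_coe_sort] at this
      simp_rw [← Finset.sum_coe_sort (Finset.Icc 1 N)
        (fun t : ℕ => r k k (_ - (t : ℤ)) ^ 2)] at this
      refine this.trans ?_
      nlinarith) m
  have e : ∀ ω, avg (fun n => wickSq (r k k 0) (g k n ω)) N ^ (2 * m)
      = (1 / (N : ℝ)) ^ (2 * m) * (∑ i : Finset.Icc 1 N, (g k (i : ℕ) ω ^ 2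
        - r k k (((i : ℕ) : ℤ) - (i : ℕ)))) ^ (2 * m) := fun ω => by
    simp_rw [sub_self]
    rw [avg, mul_pow, Finset.sum_coe_sort (Finset.Icc 1 N)
      (fun t : ℕ => g k t ω ^ 2 - r k k 0)]
    rfl
  simp_rw [e]
  rw [integral_const_mul]
  calc _ ≤ (1 / (N : ℝ)) ^ (2 * m) *
        ((2 * m).factorial * 16 ^ m * (2 * Real.exp 1) * (N * (T + 1)) ^ m) := by gcongr
    _ = _ := by
      have : (1 / (N : ℝ)) ^ (2 * m) * (N : ℝ) ^ m = (1 / (N : ℝ)) ^ m := by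
        rw [two_mul, pow_add, mul_assoc, ← mul_pow (1 / (N : ℝ)) N]
        simp [hN0.ne']
      rw [mul_pow, ← this]; ring

lemma exists_integral_avg_wickFourth_sq_le (h : IsStationaryGaussianFamily μ g r) (k : κ) :
    ∃ K : ℝ, 0 ≤ K ∧ ∀ N : ℕ, 1 ≤ N →
      ∫ ω, avg (fun n => wickFourth (r k k 0) (g k n ω)) N ^ 2 ∂μ ≤ K * (1 / (N : ℝ)) := by
  have hs := h.summable k k
  -- A square-summable correlation is bounded, so its fourth powers are summable too.
  have hs4 : Summable fun τ => 24 * r k k τ ^ 4 := by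
    refine Summable.mul_left _ (Summable.of_nonneg_of_le (fun τ => by positivity) (fun τ => ?_)
      (hs.mul_left (∑' τ, r k k τ ^ 2)))
    have := hs.le_tsum τ fun _ _ => sq_nonneg _
    calc r k k τ ^ 4 = r k k τ ^ 2 * r k k τ ^ 2 := by ring
      _ ≤ _ := by gcongr
  refine ⟨∑' τ, 24 * r k k τ ^ 4, tsum_nonneg fun τ => by positivity, fun N hN => ?_⟩
  have hN0 : (0 : ℝ) < N := by exact_mod_cast hN
  simp_rw [sq (avg _ _)]
  rw [(h.integral_avg_wick k k N).2.2, lagAvg]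
  calc _ ≤ 1 / (N : ℝ) ^ 2 * (N * ∑' τ, 24 * r k k τ ^ 4) := by
        gcongr
        exact sum_sum_lag_le hs4 (fun τ => by positivity) N
    _ = _ := by field_simp

/-- Convexity and stationarity give only boundedness, with no decay in `N`. This suffices because
`integral_error_terms_le` gives the fourth moment a small weight. -/
lemma exists_integral_avg_wickFourth_pow_four_le (h : IsStationaryGaussianFamily μ g r) (k : κ) :
    ∃ K : ℝ, 0 ≤ K ∧ ∀ N : ℕ,
      ∫ ω, avg (fun n => wickFourth (r k k 0) (g k n ω)) N ^ 4 ∂μ ≤ K := by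
  have m4 := fun n => (h.hasAllMoments k n).wickFourth (r k k 0)
  refine ⟨∫ x, wickFourth (r k k 0) x ^ 4 ∂gaussianReal 0 (r k k 0).toNNReal,
    integral_nonneg fun x => by positivity, fun N => ?_⟩
  have hst : ∀ n : ℤ, ∫ ω, wickFourth (r k k 0) (g k n ω) ^ 4 ∂μ
      = ∫ x, wickFourth (r k k 0) x ^ 4 ∂gaussianReal 0 (r k k 0).toNNReal := fun n => by
    have hg := h.gaussian.hasGaussianLaw_eval (k, n)
    have := map_eq_gaussianReal_of_centred hg (h.mean k n)
    simp only [h.integral_sq] at this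
    rw [← this, integral_map hg.aemeasurable]
    unfold wickFourth
    fun_prop
  calc _ ≤ ∫ ω, avg (fun n => wickFourth (r k k 0) (g k n ω) ^ 4) N ∂μ :=
        integral_mono ((HasAllMoments.avg m4 N).pow 4).integrable
          (HasAllMoments.avg (fun n => (m4 n).pow 4) N).integrable fun ω => avg_pow_four_le _ N
    _ ≤ _ := by
        unfold avg
        rw [integral_const_mul, integral_finsetSum _ fun (n : ℕ) _ => ((m4 n).pow 4).integrable]
        simp_rw [hst]
        rcases Nat.eq_zero_or_pos N with rfl | hN
        · simp only [Nat.cast_zero, div_zero, zero_mul]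
          exact integral_nonneg fun x => by positivity
        · have hN0 : (0 : ℝ) < N := by exact_mod_cast hN
          simp [hN0.ne']

end IsStationaryGaussianFamily

end StationaryProcess

/-! ### Expansion of the planar kurtosis around the identity covariance -/

section Expansion

/-- A function of three small variables of order `m`, in the sense that `t ^ m` can be factored out
when they are scaled by `t`, is bounded by a multiple of the `m`-th power of their size. -/
lemma exists_abs_le_of_order (G : ℝ → ℝ → ℝ → ℝ) (m : ℕ) (F : ℝ → ℝ → ℝ → ℝ → ℝ)
    (hF : Continuous fun p : ℝ × ℝ × ℝ × ℝ => F p.1 p.2.1 p.2.2.1 p.2.2.2)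
    (h : ∀ t a b c, G (t * a) (t * b) (t * c) = t ^ m * F t a b c) :
    ∃ K, 0 ≤ K ∧ ∀ r x y z, r ≤ 1 / 4 → |x| ≤ r → |y| ≤ r → |z| ≤ r → |G x y z| ≤ K * r ^ m := by
  have hc : IsCompact (Set.Icc (0 : ℝ) (1 / 4) ×ˢ Set.Icc (-1 : ℝ) 1 ×ˢ Set.Icc (-1 : ℝ) 1 ×ˢ
      Set.Icc (-1 : ℝ) 1) := isCompact_Icc.prod (isCompact_Icc.prod (isCompact_Icc.prod isCompact_Icc))
  obtain ⟨K, hK⟩ := hc.exists_bound_of_continuousOn hF.continuousOn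
  refine ⟨max K 0, le_max_right _ _, fun r x y z hr hx hy hz => ?_⟩
  have hr0 : 0 ≤ r := (abs_nonneg x).trans hx
  -- For `r = 0` the quotient is `0` by convention and `w` vanishes, so the rescaling remains valid.
  have scale : ∀ w, |w| ≤ r → w = r * (w / r) ∧ w / r ∈ Set.Icc (-1 : ℝ) 1 := fun w hw => by
    constructor
    · rcases hr0.eq_or_lt with h0 | h0
      · rw [← h0] at hw ⊢
        simpa using hw
      · field_simp
    · rw [Set.mem_Icc, ← abs_le, abs_div, abs_of_nonneg hr0]
      exact div_le_one_of_le₀ hw hr0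
  obtain ⟨ex, mx⟩ := scale x hx
  obtain ⟨ey, my⟩ := scale y hy
  obtain ⟨ez, mz⟩ := scale z hz
  have hb := hK (r, x / r, y / r, z / r) ⟨⟨hr0, hr⟩, mx, my, mz⟩
  rw [ex, ey, ez, h, abs_mul, abs_of_nonneg (by positivity : 0 ≤ r ^ m), mul_comm]
  gcongr
  exact hb.trans (le_max_left _ _)

/-- The quadratic term of the expansion of the sample kurtosis in the error of the sample
covariance. -/
def quadTerm (x y z : ℝ) : ℝ := 3 * x ^ 2 + 3 * y ^ 2 + 2 * x * y + 4 * z ^ 2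

/-- The mixed term of the expansion of the sample kurtosis. -/
def mixedTerm (x y z h40 h31 h22 h13 h04 : ℝ) : ℝ :=
  -2 * (x * (h40 + h22) + 2 * z * (h31 + h13) + y * (h22 + h04))

/-- The sample kurtosis of planar data, as a function of its moments of order two and four. -/
noncomputable def planarKurtosis (P Q R m40 m31 m22 m13 m04 : ℝ) : ℝ :=
  (Q ^ 2 * m40 - 4 * Q * R * m31 + (2 * P * Q + 4 * R ^ 2) * m22 - 4 * P * R * m13 + P ^ 2 * m04)
    / (P * Q - R ^ 2) ^ 2

lemma half_le_det {x y z : ℝ} (hx : |x| ≤ 1 / 4) (hy : |y| ≤ 1 / 4) (hz : |z| ≤ 1 / 4) :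
    1 / 2 ≤ (1 + x) * (1 + y) - z ^ 2 := by
  have hx' := abs_le.1 hx
  have hy' := abs_le.1 hy
  have hz' := sq_le_sq' (abs_le.1 hz).1 (abs_le.1 hz).2
  nlinarith [mul_nonneg (by linarith [hx'.1] : 0 ≤ x + 1 / 4) (by linarith [hy'.1] : 0 ≤ y + 1 / 4)]

/-- The `h`'s are the averaged fourth Wick powers, so the fourth moments are shifted by the
lower-order terms of the Hermite polynomials. The kurtosis is affine in the `h`'s; after
multiplication by the squared determinant the error becomes a polynomial. Its `h`-free part vanishes
to order three (the linear terms cancel), and each coefficient of an `h` vanishes to order two. -/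
lemma exists_planarKurtosis_expansion : ∃ K : ℝ, 0 ≤ K ∧ ∀ r hh x y z h40 h31 h22 h13 h04 : ℝ,
    r ≤ 1 / 4 → |x| ≤ r → |y| ≤ r → |z| ≤ r →
    |h40| ≤ hh → |h31| ≤ hh → |h22| ≤ hh → |h13| ≤ hh → |h04| ≤ hh →
    1 / 2 ≤ (1 + x) * (1 + y) - z ^ 2 ∧
    |planarKurtosis (1 + x) (1 + y) z (h40 + 6 * (1 + x) - 3) (h31 + 3 * z)
      (h22 + (1 + x) + (1 + y) - 1) (h13 + 3 * z) (h04 + 6 * (1 + y) - 3)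
      - (8 + (h40 + 2 * h22 + h04) - quadTerm x y z + mixedTerm x y z h40 h31 h22 h13 h04)|
      ≤ K * (hh * r ^ 2 + r ^ 3) := by
  -- `K0` treats the `h`-free part and `K1`, ..., `K5` the coefficients of `h40`, `h31`, `h22`,
  -- `h13`, `h04`. The long polynomials are the explicit quotients by `t^3` or `t^2`.
  obtain ⟨K0, hK0, H0⟩ := exists_abs_le_of_order
    (fun x y z => (1 + y) ^ 2 * (6 * (1 + x) - 3) - 12 * (1 + y) * z * z
        + (2 * (1 + x) * (1 + y) + 4 * z ^ 2) * (1 + x + y) - 12 * (1 + x) * z * z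
        + (1 + x) ^ 2 * (6 * (1 + y) - 3)
        - (8 - quadTerm x y z) * ((1 + x) * (1 + y) - z ^ 2) ^ 2) 3 (fun t a b c =>
      16 * b * c ^ 2 + 6 * b ^ 3 + 16 * a * c ^ 2 + 2 * a * b ^ 2 + 2 * a ^ 2 * b + 6 * a ^
        3 - 16 * t * c ^ 4 - 2 * t * b ^ 2 * c ^ 2 + 3 * t * b ^ 4 + 28 * t * a * b * c ^ 2
        + 14 * t * a * b ^ 3 - 2 * t * a ^ 2 * c ^ 2 + 6 * t * a ^ 2 * b ^ 2 + 14 * t * a ^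
        3 * b + 3 * t * a ^ 4 - 8 * t ^ 2 * b * c ^ 4 - 6 * t ^ 2 * b ^ 3 * c ^ 2 - 8 * t ^
        2 * a * c ^ 4 - 2 * t ^ 2 * a * b ^ 2 * c ^ 2 + 6 * t ^ 2 * a * b ^ 4 - 2 * t ^ 2 *
        a ^ 2 * b * c ^ 2 + 10 * t ^ 2 * a ^ 2 * b ^ 3 - 6 * t ^ 2 * a ^ 3 * c ^ 2 + 10 * t
        ^ 2 * a ^ 3 * b ^ 2 + 6 * t ^ 2 * a ^ 4 * b + 4 * t ^ 3 * c ^ 6 + 3 * t ^ 3 * b ^ 2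
        * c ^ 4 - 6 * t ^ 3 * a * b * c ^ 4 - 6 * t ^ 3 * a * b ^ 3 * c ^ 2 + 3 * t ^ 3 * a
        ^ 2 * c ^ 4 + 3 * t ^ 3 * a ^ 2 * b ^ 4 - 6 * t ^ 3 * a ^ 3 * b * c ^ 2 + 2 * t ^ 3
        * a ^ 3 * b ^ 3 + 3 * t ^ 3 * a ^ 4 * b ^ 2) (by fun_prop)
    (fun t a b c => by simp only [quadTerm]; ring)
  obtain ⟨K1, hK1, H1⟩ := exists_abs_le_of_order
    (fun x y z => (1 + y) ^ 2 - (1 - 2 * x) * ((1 + x) * (1 + y) - z ^ 2) ^ 2) 2 (fun t a b c =>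
      2 * c ^ 2 + 3 * a ^ 2 + 2 * t * b * c ^ 2 - 2 * t * a * c ^ 2 + 6 * t * a ^ 2 * b + 2
        * t * a ^ 3 - t ^ 2 * c ^ 4 - 2 * t ^ 2 * a * b * c ^ 2 - 4 * t ^ 2 * a ^ 2 * c ^ 2
        + 3 * t ^ 2 * a ^ 2 * b ^ 2 + 4 * t ^ 2 * a ^ 3 * b + 2 * t ^ 3 * a * c ^ 4 - 4 * t
        ^ 3 * a ^ 2 * b * c ^ 2 + 2 * t ^ 3 * a ^ 3 * b ^ 2) (by fun_prop)
    (fun t a b c => by ring)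
  obtain ⟨K2, hK2, H2⟩ := exists_abs_le_of_order
    (fun x y z => -4 * (1 + y) * z + 4 * z * ((1 + x) * (1 + y) - z ^ 2) ^ 2) 2 (fun t a b c =>
      4 * b * c + 8 * a * c - 8 * t * c ^ 3 + 4 * t * b ^ 2 * c + 16 * t * a * b * c + 4 * t
        * a ^ 2 * c - 8 * t ^ 2 * b * c ^ 3 - 8 * t ^ 2 * a * c ^ 3 + 8 * t ^ 2 * a * b ^ 2
        * c + 8 * t ^ 2 * a ^ 2 * b * c + 4 * t ^ 3 * c ^ 5 - 8 * t ^ 3 * a * b * c ^ 3 + 4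
        * t ^ 3 * a ^ 2 * b ^ 2 * c) (by fun_prop)
    (fun t a b c => by ring)
  obtain ⟨K3, hK3, H3⟩ := exists_abs_le_of_order
    (fun x y z => 2 * (1 + x) * (1 + y) + 4 * z ^ 2
        - (2 - 2 * x - 2 * y) * ((1 + x) * (1 + y) - z ^ 2) ^ 2) 2 (fun t a b c =>
      8 * c ^ 2 + 2 * b ^ 2 + 2 * a * b + 2 * a ^ 2 + 2 * t * b ^ 3 + 6 * t * a * b ^ 2 + 6
        * t * a ^ 2 * b + 2 * t * a ^ 3 - 2 * t ^ 2 * c ^ 4 - 4 * t ^ 2 * b ^ 2 * c ^ 2 - 4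
        * t ^ 2 * a * b * c ^ 2 + 4 * t ^ 2 * a * b ^ 3 - 4 * t ^ 2 * a ^ 2 * c ^ 2 + 6 * t
        ^ 2 * a ^ 2 * b ^ 2 + 4 * t ^ 2 * a ^ 3 * b + 2 * t ^ 3 * b * c ^ 4 + 2 * t ^ 3 * a
        * c ^ 4 - 4 * t ^ 3 * a * b ^ 2 * c ^ 2 - 4 * t ^ 3 * a ^ 2 * b * c ^ 2 + 2 * t ^ 3
        * a ^ 2 * b ^ 3 + 2 * t ^ 3 * a ^ 3 * b ^ 2) (by fun_prop)
    (fun t a b c => by ring)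
  obtain ⟨K4, hK4, H4⟩ := exists_abs_le_of_order
    (fun x y z => -4 * (1 + x) * z + 4 * z * ((1 + x) * (1 + y) - z ^ 2) ^ 2) 2 (fun t a b c =>
      8 * b * c + 4 * a * c - 8 * t * c ^ 3 + 4 * t * b ^ 2 * c + 16 * t * a * b * c + 4 * t
        * a ^ 2 * c - 8 * t ^ 2 * b * c ^ 3 - 8 * t ^ 2 * a * c ^ 3 + 8 * t ^ 2 * a * b ^ 2
        * c + 8 * t ^ 2 * a ^ 2 * b * c + 4 * t ^ 3 * c ^ 5 - 8 * t ^ 3 * a * b * c ^ 3 + 4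
        * t ^ 3 * a ^ 2 * b ^ 2 * c) (by fun_prop)
    (fun t a b c => by ring)
  obtain ⟨K5, hK5, H5⟩ := exists_abs_le_of_order
    (fun x y z => (1 + x) ^ 2 - (1 - 2 * y) * ((1 + x) * (1 + y) - z ^ 2) ^ 2) 2 (fun t a b c =>
      2 * c ^ 2 + 3 * b ^ 2 - 2 * t * b * c ^ 2 + 2 * t * b ^ 3 + 2 * t * a * c ^ 2 + 6 * t
        * a * b ^ 2 - t ^ 2 * c ^ 4 - 4 * t ^ 2 * b ^ 2 * c ^ 2 - 2 * t ^ 2 * a * b * c ^ 2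
        + 4 * t ^ 2 * a * b ^ 3 + 3 * t ^ 2 * a ^ 2 * b ^ 2 + 2 * t ^ 3 * b * c ^ 4 - 4 * t
        ^ 3 * a * b ^ 2 * c ^ 2 + 2 * t ^ 3 * a ^ 2 * b ^ 3) (by fun_prop)
    (fun t a b c => by ring)
  -- The factor 4 pays for the division by `D²`, as `D ≥ 1/2`.
  refine ⟨4 * (K0 + K1 + K2 + K3 + K4 + K5), by positivity,
    fun r hh x y z h40 h31 h22 h13 h04 hr hx hy hz i40 i31 i22 i13 i04 => ?_⟩
  specialize H0 r x y z hr hx hy hz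
  specialize H1 r x y z hr hx hy hz
  specialize H2 r x y z hr hx hy hz
  specialize H3 r x y z hr hx hy hz
  specialize H4 r x y z hr hx hy hz
  specialize H5 r x y z hr hx hy hz
  have hr0 : 0 ≤ r := (abs_nonneg x).trans hx
  have hh0 : 0 ≤ hh := (abs_nonneg _).trans i40
  have hD : 1 / 2 ≤ (1 + x) * (1 + y) - z ^ 2 :=
    half_le_det (hx.trans hr) (hy.trans hr) (hz.trans hr)
  refine ⟨hD, ?_⟩
  generalize hT0 : (1 + y) ^ 2 * (6 * (1 + x) - 3) - 12 * (1 + y) * z * z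
        + (2 * (1 + x) * (1 + y) + 4 * z ^ 2) * (1 + x + y) - 12 * (1 + x) * z * z
        + (1 + x) ^ 2 * (6 * (1 + y) - 3)
        - (8 - quadTerm x y z) * ((1 + x) * (1 + y) - z ^ 2) ^ 2 = T0 at H0
  generalize hT1 : (1 + y) ^ 2 - (1 - 2 * x) * ((1 + x) * (1 + y) - z ^ 2) ^ 2 = T1 at H1
  generalize hT2 : -4 * (1 + y) * z + 4 * z * ((1 + x) * (1 + y) - z ^ 2) ^ 2 = T2 at H2
  generalize hT3 : 2 * (1 + x) * (1 + y) + 4 * z ^ 2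
        - (2 - 2 * x - 2 * y) * ((1 + x) * (1 + y) - z ^ 2) ^ 2 = T3 at H3
  generalize hT4 : -4 * (1 + x) * z + 4 * z * ((1 + x) * (1 + y) - z ^ 2) ^ 2 = T4 at H4
  generalize hT5 : (1 + x) ^ 2 - (1 - 2 * y) * ((1 + x) * (1 + y) - z ^ 2) ^ 2 = T5 at H5
  generalize hDdef : (1 + x) * (1 + y) - z ^ 2 = D at hD hT0 hT1 hT2 hT3 hT4 hT5
  have hDne : D ^ 2 ≠ 0 := by positivity
  have e : planarKurtosis (1 + x) (1 + y) z (h40 + 6 * (1 + x) - 3) (h31 + 3 * z)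
      (h22 + (1 + x) + (1 + y) - 1) (h13 + 3 * z) (h04 + 6 * (1 + y) - 3)
      - (8 + (h40 + 2 * h22 + h04) - quadTerm x y z + mixedTerm x y z h40 h31 h22 h13 h04)
      = (T0 + (h40 * T1 + h31 * T2 + h22 * T3 + h13 * T4 + h04 * T5)) / D ^ 2 := by
    rw [planarKurtosis, hDdef, eq_div_iff hDne, sub_mul, div_mul_cancel₀ _ hDne,
      ← hT0, ← hT1, ← hT2, ← hT3, ← hT4, ← hT5, mixedTerm]
    ring
  rw [e, abs_div, abs_of_pos (by positivity : 0 < D ^ 2), div_le_iff₀ (by positivity)]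
  have prod : ∀ h T K : ℝ, |h| ≤ hh → |T| ≤ K * r ^ 2 → |h * T| ≤ K * (hh * r ^ 2) :=
    fun h T K h1 h2 => by
      rw [abs_mul]
      calc |h| * |T| ≤ hh * (K * r ^ 2) := by gcongr
        _ = _ := by ring
  have p1 := prod _ _ _ i40 H1
  have p2 := prod _ _ _ i31 H2
  have p3 := prod _ _ _ i22 H3
  have p4 := prod _ _ _ i13 H4
  have p5 := prod _ _ _ i04 H5
  have hD4 : 1 ≤ 4 * D ^ 2 := by
    have := pow_le_pow_left₀ (by norm_num) hD 2
    linarith only [this]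
  have tri : |T0 + (h40 * T1 + h31 * T2 + h22 * T3 + h13 * T4 + h04 * T5)|
      ≤ (K0 + K1 + K2 + K3 + K4 + K5) * (hh * r ^ 2 + r ^ 3) := by
    have q1 := abs_add_le T0 (h40 * T1 + h31 * T2 + h22 * T3 + h13 * T4 + h04 * T5)
    have q2 := abs_add_le (h40 * T1 + h31 * T2 + h22 * T3 + h13 * T4) (h04 * T5)
    have q3 := abs_add_le (h40 * T1 + h31 * T2 + h22 * T3) (h13 * T4)
    have q4 := abs_add_le (h40 * T1 + h31 * T2) (h22 * T3)
    have q5 := abs_add_le (h40 * T1) (h31 * T2)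
    have a1 : 0 ≤ hh * r ^ 2 := by positivity
    have a2 : 0 ≤ r ^ 3 := by positivity
    have b0 := mul_nonneg hK0 a1
    have b1 := mul_nonneg (by positivity : 0 ≤ K1 + K2 + K3 + K4 + K5) a2
    linarith only [q1, q2, q3, q4, q5, H0, p1, p2, p3, p4, p5, b0, b1]
  refine tri.trans ?_
  have : 0 ≤ (K0 + K1 + K2 + K3 + K4 + K5) * (hh * r ^ 2 + r ^ 3) := by positivity
  calc _ = 1 * ((K0 + K1 + K2 + K3 + K4 + K5) * (hh * r ^ 2 + r ^ 3)) := (one_mul _).symm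
    _ ≤ 4 * D ^ 2 * ((K0 + K1 + K2 + K3 + K4 + K5) * (hh * r ^ 2 + r ^ 3)) := by gcongr
    _ = _ := by ring

/-- Global form of the expansion of the sample kurtosis, for data for which it is at most `4 n`. -/
lemma exists_planarKurtosis_expansion_global : ∃ K : ℝ, 0 ≤ K ∧
    ∀ n B r hh x y z h40 h31 h22 h13 h04 : ℝ, 1 ≤ n → 0 ≤ B → B ≤ 4 * n →
    |x| ≤ r → |y| ≤ r → |z| ≤ r →
    |h40| ≤ hh → |h31| ≤ hh → |h22| ≤ hh → |h13| ≤ hh → |h04| ≤ hh →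
    ((1 + x) * (1 + y) - z ^ 2 ≠ 0 →
      B = planarKurtosis (1 + x) (1 + y) z (h40 + 6 * (1 + x) - 3) (h31 + 3 * z)
        (h22 + (1 + x) + (1 + y) - 1) (h13 + 3 * z) (h04 + 6 * (1 + y) - 3)) →
    |B - (8 + (h40 + 2 * h22 + h04) - quadTerm x y z + mixedTerm x y z h40 h31 h22 h13 h04)|
      ≤ K * (hh * r ^ 2 + r ^ 3 + n * r ^ 6) ∧
    |B - (8 + (h40 + 2 * h22 + h04))| ≤ K * (hh * r + r ^ 2 + n * r ^ 6) := by
  obtain ⟨K, hK, H⟩ := exists_planarKurtosis_expansion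
  -- The large constant is only a convenient bound for the regime `r > 1/4`, where `4096 = 4^6`
  -- enters.
  refine ⟨K + 100000, by positivity, fun n B r hh x y z h40 h31 h22 h13 h04 hn hB0 hB hx hy hz
    i40 i31 i22 i13 i04 hBeq => ?_⟩
  have hr0 : 0 ≤ r := (abs_nonneg x).trans hx
  have hh0 : 0 ≤ hh := (abs_nonneg _).trans i40
  have prod : ∀ u v a b : ℝ, |u| ≤ a → |v| ≤ b → |u * v| ≤ a * b := fun u v a b h1 h2 => by
    rw [abs_mul]; exact mul_le_mul h1 h2 (abs_nonneg _) ((abs_nonneg _).trans h1)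
  have hQ : |quadTerm x y z| ≤ 12 * r ^ 2 := by
    have q1 := abs_le.1 (prod x x r r hx hx)
    have q2 := abs_le.1 (prod y y r r hy hy)
    have q3 := abs_le.1 (prod x y r r hx hy)
    have q4 := abs_le.1 (prod z z r r hz hz)
    rw [quadTerm, abs_le]
    constructor <;> linarith
  have hL : |mixedTerm x y z h40 h31 h22 h13 h04| ≤ 16 * (hh * r) := by
    have q1 := abs_le.1 (prod x h40 r hh hx i40)
    have q2 := abs_le.1 (prod x h22 r hh hx i22)
    have q3 := abs_le.1 (prod z h31 r hh hz i31)
    have q4 := abs_le.1 (prod z h13 r hh hz i13)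
    have q5 := abs_le.1 (prod y h22 r hh hy i22)
    have q6 := abs_le.1 (prod y h04 r hh hy i04)
    rw [mixedTerm, abs_le]
    constructor <;> linarith
  have hhr : 0 ≤ hh * r := by positivity
  have hr2 : 0 ≤ r ^ 2 := by positivity
  have hhr2 : 0 ≤ hh * r ^ 2 := by positivity
  have hr3 : 0 ≤ r ^ 3 := by positivity
  have hnr : 0 ≤ n * r ^ 6 := by positivity
  rw [abs_le] at hQ hL
  by_cases hr : r ≤ 1 / 4
  · obtain ⟨hD, hb⟩ := H r hh x y z h40 h31 h22 h13 h04 hr hx hy hz i40 i31 i22 i13 i04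
    rw [← hBeq (by positivity)] at hb
    have k1 : hh * r ^ 2 ≤ hh * r := by nlinarith
    have k2 : r ^ 3 ≤ r ^ 2 := by nlinarith
    have k3 := mul_nonneg hK hnr
    have k4 := mul_le_mul_of_nonneg_left (add_le_add k1 k2) hK
    refine ⟨hb.trans (by linarith), ?_⟩
    rw [abs_le] at hb ⊢
    constructor <;> linarith
  -- No expansion is used here. Since `4 r > 1`, every term may be multiplied by powers of `4 r`,
  -- and `B ≤ 4 n` is absorbed by `n r^6`. The power four would yield a mean of order `1/N` when `n
  -- = N`, too large by itself; six is the next even power.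
  · push Not at hr
    have i1 := abs_le.1 i40
    have i2 := abs_le.1 i22
    have i3 := abs_le.1 i04
    have r2 : 1 ≤ 16 * r ^ 2 := by nlinarith
    have r6 : 1 ≤ 4096 * r ^ 6 := by
      have := pow_le_pow_left₀ (by norm_num) r2 3
      linarith [show (16 * r ^ 2) ^ 3 = 4096 * r ^ 6 by ring]
    have k0 : n ≤ 4096 * (n * r ^ 6) := by nlinarith
    have k1 : hh ≤ 4 * (hh * r) := by nlinarith
    have k2 : hh * r ≤ 4 * (hh * r ^ 2) := by nlinarith
    have k3 : r ^ 2 ≤ 4 * r ^ 3 := by nlinarith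
    have k4 := mul_nonneg hK (add_nonneg (add_nonneg hhr2 hr3) hnr)
    have k5 := mul_nonneg hK (add_nonneg (add_nonneg hhr hr2) hnr)
    constructor <;> rw [abs_le] <;> constructor <;> linarith

end Expansion

/-! ### Sample kurtosis in linearly transformed coordinates -/

section PlanarData

lemma avg_add (f g : ℤ → ℝ) (N : ℕ) : avg (fun n => f n + g n) N = avg f N + avg g N := by
  simp only [avg, Finset.sum_add_distrib, mul_add]

lemma avg_sub (f g : ℤ → ℝ) (N : ℕ) : avg (fun n => f n - g n) N = avg f N - avg g N := by
  simp only [avg, Finset.sum_sub_distrib, mul_sub]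

lemma avg_const_mul (c : ℝ) (f : ℤ → ℝ) (N : ℕ) : avg (fun n => c * f n) N = c * avg f N := by
  simp only [avg, ← Finset.mul_sum]; ring

lemma avg_const (c : ℝ) {N : ℕ} (hN : 1 ≤ N) : avg (fun _ => c) N = c := by
  have : (N : ℝ) ≠ 0 := by positivity
  simp [avg, this]

lemma avg_nonneg {f : ℤ → ℝ} (hf : ∀ n, 0 ≤ f n) (N : ℕ) : 0 ≤ avg f N :=
  mul_nonneg (by positivity) (Finset.sum_nonneg fun _ _ => hf _)

lemma sq_avg_mul_le (u v : ℤ → ℝ) (N : ℕ) :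
    avg (fun n => u n * v n) N ^ 2 ≤ avg (fun n => u n ^ 2) N * avg (fun n => v n ^ 2) N := by
  have := Finset.sum_mul_sq_le_sq_mul_sq (Finset.Icc 1 N) (fun n : ℕ => u n) (fun n : ℕ => v n)
  calc _ = (1 / (N : ℝ)) ^ 2 * (∑ n ∈ Finset.Icc 1 N, u n * v n) ^ 2 := by rw [avg, mul_pow]
    _ ≤ (1 / (N : ℝ)) ^ 2 * ((∑ n ∈ Finset.Icc 1 N, u n ^ 2) * ∑ n ∈ Finset.Icc 1 N, v n ^ 2) := by
      gcongr
    _ = _ := by rw [avg, avg]; ring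

lemma avg_sq_le_of_avg_le {f : ℤ → ℝ} (hf : ∀ n, 0 ≤ f n) {N : ℕ} {c : ℝ} (h : avg f N ≤ c) :
    avg (fun n => f n ^ 2) N ≤ c ^ 2 * N := by
  rcases Nat.eq_zero_or_pos N with rfl | hN
  · simp [avg]
  have hN0 : (0 : ℝ) < N := by exact_mod_cast hN
  have h1 : ∑ n ∈ Finset.Icc 1 N, f n ^ 2 ≤ (∑ n ∈ Finset.Icc 1 N, f n) ^ 2 :=
    Finset.sum_sq_le_sq_sum_of_nonneg fun _ _ => hf _
  have h2 : ∑ n ∈ Finset.Icc 1 N, f n = N * avg f N := by rw [avg]; field_simp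
  calc avg (fun n => f n ^ 2) N ≤ 1 / (N : ℝ) * (N * avg f N) ^ 2 := by
        rw [avg, ← h2]; gcongr
    _ = avg f N ^ 2 * N := by field_simp
    _ ≤ c ^ 2 * N := by
        have := avg_nonneg hf N
        gcongr

/-- The squared Mahalanobis norm of the planar vector `(s, t)` relative to the sample second
moments `P, Q, R`. -/
noncomputable def planarForm (P Q R s t : ℝ) : ℝ :=
  (Q * s ^ 2 - 2 * R * (s * t) + P * t ^ 2) / (P * Q - R ^ 2)

/-- Multiplied by `P`, the numerator is `(R s - P t)² + (P Q - R²) s²`. In the degenerate case the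
form is zero, being a quotient by zero. -/
lemma planarForm_nonneg {P Q R : ℝ} (hP : 0 ≤ P) (hR : R ^ 2 ≤ P * Q) (s t : ℝ) :
    0 ≤ planarForm P Q R s t := by
  rcases hR.eq_or_lt with h | h
  · simp [planarForm, h]
  · have hP' : 0 < P := lt_of_le_of_ne hP fun h0 => by
      rw [← h0] at h; nlinarith [sq_nonneg R]
    refine div_nonneg ?_ (by linarith)
    have : 0 ≤ P * (Q * s ^ 2 - 2 * R * (s * t) + P * t ^ 2) := by
      nlinarith [sq_nonneg (R * s - P * t), mul_nonneg (sub_nonneg.2 h.le) (sq_nonneg s)]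
    exact nonneg_of_mul_nonneg_right this hP'

variable {Ω : Type*} {x : ℤ → Ω → Fin 2 → ℝ} {u v : ℤ → Ω → ℝ} {α β : ℝ}

/-- Linear invariance of the Mahalanobis norm. The determinant and the adjugate form both acquire
the factor `4 α² β²`. No case split on singularity is needed: a singular matrix has inverse zero,
which matches division by zero in `planarForm`. -/
lemma mardiaKurtosis_eq_avg (hα : α ≠ 0) (hβ : β ≠ 0)
    (h0 : ∀ n ω, x n ω 0 = α * u n ω + β * v n ω)
    (h1 : ∀ n ω, x n ω 1 = α * u n ω - β * v n ω) (N : ℕ) (ω : Ω) :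
    mardiaKurtosis x N ω = avg (fun n => planarForm (avg (fun n => u n ω ^ 2) N)
      (avg (fun n => v n ω ^ 2) N) (avg (fun n => u n ω * v n ω) N) (u n ω) (v n ω) ^ 2) N := by
  set P := avg (fun n => u n ω ^ 2) N with hP
  set Q := avg (fun n => v n ω ^ 2) N with hQ
  set R := avg (fun n => u n ω * v n ω) N with hR
  have hS : ∀ a b, sampleCov x N ω a b = avg (fun n => x n ω a * x n ω b) N := fun a b => by
    simp [sampleCov, avg, Matrix.sum_apply, Matrix.vecMulVec_apply]
  have s00 : sampleCov x N ω 0 0 = α ^ 2 * P + 2 * α * β * R + β ^ 2 * Q := by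
    rw [hS, hP, hQ, hR, ← avg_const_mul, ← avg_const_mul, ← avg_const_mul, ← avg_add, ← avg_add]
    congr 1; ext n; rw [h0]; ring
  have s01 : sampleCov x N ω 0 1 = α ^ 2 * P - β ^ 2 * Q := by
    rw [hS, hP, hQ, ← avg_const_mul, ← avg_const_mul, ← avg_sub]
    congr 1; ext n; rw [h0, h1]; ring
  have s10 : sampleCov x N ω 1 0 = α ^ 2 * P - β ^ 2 * Q := by
    rw [hS, hP, hQ, ← avg_const_mul, ← avg_const_mul, ← avg_sub]
    congr 1; ext n; rw [h0, h1]; ring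
  have s11 : sampleCov x N ω 1 1 = α ^ 2 * P - 2 * α * β * R + β ^ 2 * Q := by
    rw [hS, hP, hQ, hR, ← avg_const_mul, ← avg_const_mul, ← avg_const_mul, ← avg_sub, ← avg_add]
    congr 1; ext n; rw [h1]; ring
  have hform : ∀ n : ℤ, x n ω ⬝ᵥ ((sampleCov x N ω)⁻¹ *ᵥ x n ω)
      = planarForm P Q R (u n ω) (v n ω) := fun n => by
    have hd : (sampleCov x N ω).det = 4 * α ^ 2 * β ^ 2 * (P * Q - R ^ 2) := by
      rw [Matrix.det_fin_two, s00, s01, s10, s11]; ring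
    have hc : 4 * α ^ 2 * β ^ 2 ≠ 0 := by positivity
    rw [Matrix.inv_def, Matrix.adjugate_fin_two, Ring.inverse_eq_inv', hd, s00, s01, s10, s11,
      planarForm, ← mul_div_mul_left _ _ hc, div_eq_inv_mul, Matrix.smul_mulVec, dotProduct_smul,
      smul_eq_mul]
    congr 1
    simp only [Matrix.mulVec, dotProduct, Fin.sum_univ_two, Matrix.of_apply, Matrix.cons_val_zero,
      Matrix.cons_val_one, h0, h1]
    ring
  simp only [mardiaKurtosis, hform]
  rfl

/-- The average of the Mahalanobis norms is `tr (Ŝ⁻¹ Ŝ)`, which is 2, or 0 if `Ŝ` is singular. A sum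
of squares of nonnegative numbers is at most the square of their sum, here at most `(2 N)²`. -/
lemma mardiaKurtosis_planar_bounds (hα : α ≠ 0) (hβ : β ≠ 0)
    (h0 : ∀ n ω, x n ω 0 = α * u n ω + β * v n ω)
    (h1 : ∀ n ω, x n ω 1 = α * u n ω - β * v n ω) (N : ℕ) (ω : Ω) :
    0 ≤ mardiaKurtosis x N ω ∧ mardiaKurtosis x N ω ≤ 4 * N := by
  rw [mardiaKurtosis_eq_avg hα hβ h0 h1]
  refine ⟨avg_nonneg (fun n => sq_nonneg _) N, ?_⟩
  have hPQ := sq_avg_mul_le (fun n => u n ω) (fun n => v n ω) N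
  have hP := avg_nonneg (fun n : ℤ => sq_nonneg (u n ω)) N
  have := avg_sq_le_of_avg_le (f := fun n => planarForm (avg (fun n => u n ω ^ 2) N)
      (avg (fun n => v n ω ^ 2) N) (avg (fun n => u n ω * v n ω) N) (u n ω) (v n ω)) (N := N) (c := 2)
      (fun n => planarForm_nonneg hP hPQ _ _) ?_
  · refine this.trans_eq ?_
    norm_num
  · set P := avg (fun n => u n ω ^ 2) N with hP
    set Q := avg (fun n => v n ω ^ 2) N with hQ
    set R := avg (fun n => u n ω * v n ω) N with hR
    simp only [planarForm, div_eq_inv_mul]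
    rw [avg_const_mul, avg_add, avg_sub, avg_const_mul, avg_const_mul, avg_const_mul, ← hP, ← hQ,
      ← hR]
    by_cases hd : P * Q - R ^ 2 = 0
    · simp [hd]
    · exact le_of_eq (by field_simp; ring)

lemma mardiaKurtosis_eq_planarKurtosis (hα : α ≠ 0) (hβ : β ≠ 0)
    (h0 : ∀ n ω, x n ω 0 = α * u n ω + β * v n ω)
    (h1 : ∀ n ω, x n ω 1 = α * u n ω - β * v n ω) (N : ℕ) (ω : Ω) :
    mardiaKurtosis x N ω = planarKurtosis (avg (fun n => u n ω ^ 2) N)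
      (avg (fun n => v n ω ^ 2) N) (avg (fun n => u n ω * v n ω) N)
      (avg (fun n => u n ω ^ 4) N) (avg (fun n => u n ω ^ 3 * v n ω) N)
      (avg (fun n => u n ω ^ 2 * v n ω ^ 2) N) (avg (fun n => u n ω * v n ω ^ 3) N)
      (avg (fun n => v n ω ^ 4) N) := by
  rw [mardiaKurtosis_eq_avg hα hβ h0 h1, planarKurtosis]
  generalize avg (fun n => u n ω ^ 2) N = P
  generalize avg (fun n => v n ω ^ 2) N = Q
  generalize avg (fun n => u n ω * v n ω) N = R
  simp only [planarForm, div_pow]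
  rw [div_eq_inv_mul, ← avg_const_mul, ← avg_const_mul, ← avg_const_mul, ← avg_const_mul,
    ← avg_const_mul, ← avg_sub, ← avg_add, ← avg_sub, ← avg_add, ← avg_const_mul]
  congr 1; ext n; ring

lemma avg_wickSq_linear (u v : ℤ → ℝ) (a b : ℝ) {N : ℕ} (hN : 1 ≤ N) :
    avg (fun n => wickSq (a ^ 2 + b ^ 2) (a * u n + b * v n)) N
      = a ^ 2 * avg (fun n => u n ^ 2) N + 2 * a * b * avg (fun n => u n * v n) N
        + b ^ 2 * avg (fun n => v n ^ 2) N - (a ^ 2 + b ^ 2) := by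
  have hc := avg_const (a ^ 2 + b ^ 2) hN
  conv_rhs => rw [← hc]
  simp only [← avg_const_mul, ← avg_add, ← avg_sub]
  congr 1; ext n; simp only [wickSq]; ring

lemma avg_wickFourth_linear (u v : ℤ → ℝ) (a b : ℝ) {N : ℕ} (hN : 1 ≤ N) :
    avg (fun n => wickFourth (a ^ 2 + b ^ 2) (a * u n + b * v n)) N
      = a ^ 4 * avg (fun n => u n ^ 4) N + 4 * a ^ 3 * b * avg (fun n => u n ^ 3 * v n) N
        + 6 * a ^ 2 * b ^ 2 * avg (fun n => u n ^ 2 * v n ^ 2) N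
        + 4 * a * b ^ 3 * avg (fun n => u n * v n ^ 3) N + b ^ 4 * avg (fun n => v n ^ 4) N
        - 6 * (a ^ 2 + b ^ 2) * (a ^ 2 * avg (fun n => u n ^ 2) N
          + 2 * a * b * avg (fun n => u n * v n) N + b ^ 2 * avg (fun n => v n ^ 2) N)
        + 3 * (a ^ 2 + b ^ 2) ^ 2 := by
  have hc := avg_const (3 * (a ^ 2 + b ^ 2) ^ 2) hN
  rw [← hc]
  simp only [← avg_const_mul, ← avg_add, ← avg_sub]
  congr 1; ext n; simp only [wickFourth]; ring

end PlanarData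

/-! ### Polarisation of the expansion along five directions -/

section Directions

/-- First coordinates of five directions in the plane, whose fourth powers span the quartic forms. -/
def dirFst : Fin 5 → ℝ := ![1, 0, 1, 1, 1]

/-- Second coordinates of the five directions. -/
def dirSnd : Fin 5 → ℝ := ![0, 1, 1, -1, 2]

/-- Averaged second Wick power in direction `k`. -/
noncomputable def dirWickSq (u v : ℤ → ℝ) (k : Fin 5) (N : ℕ) : ℝ :=
  avg (fun n => wickSq (dirFst k ^ 2 + dirSnd k ^ 2) (dirFst k * u n + dirSnd k * v n)) N

/-- Averaged fourth Wick power in direction `k`. -/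
noncomputable def dirWickFourth (u v : ℤ → ℝ) (k : Fin 5) (N : ℕ) : ℝ :=
  avg (fun n => wickFourth (dirFst k ^ 2 + dirSnd k ^ 2) (dirFst k * u n + dirSnd k * v n)) N

/-- Coefficients expressing the fully contracted Wick quartic. -/
noncomputable def traceCoeff : Fin 5 → ℝ := ![2 / 3, 2 / 3, 1 / 6, 1 / 6, 0]

/-- Coefficients of the quadratic term of the kurtosis expansion. -/
def quadCoeff : Fin 5 → Fin 5 → ℝ :=
  ![![4, 4, 0, 0, 0], ![0, 4, 0, 0, 0], ![-2, -2, 1, 0, 0], ![0, 0, 0, 0, 0], ![0, 0, 0, 0, 0]]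

/-- Coefficients of the mixed term of the kurtosis expansion. -/
noncomputable def mixedCoeff : Fin 5 → Fin 5 → ℝ :=
  ![![-5 / 3, 1 / 3, 1 / 12, -5 / 12, 0], ![1 / 3, -5 / 3, 1 / 12, -5 / 12, 0],
    ![0, 0, -1 / 4, 1 / 4, 0], ![0, 0, 0, 0, 0], ![0, 0, 0, 0, 0]]

/-- Expansion of the sample kurtosis in averaged Wick powers. -/
lemma exists_mardiaKurtosis_expansion : ∃ K : ℝ, 0 ≤ K ∧
    ∀ {Ω : Type*} {x : ℤ → Ω → Fin 2 → ℝ} {u v : ℤ → Ω → ℝ} {α β : ℝ}, α ≠ 0 → β ≠ 0 →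
    (∀ n ω, x n ω 0 = α * u n ω + β * v n ω) → (∀ n ω, x n ω 1 = α * u n ω - β * v n ω) →
    ∀ (N : ℕ) (ω : Ω), 1 ≤ N → ∀ D A : Fin 5 → ℝ,
    (∀ k, D k = dirWickSq (fun n => u n ω) (fun n => v n ω) k N) →
    (∀ k, A k = dirWickFourth (fun n => u n ω) (fun n => v n ω) k N) →
    |mardiaKurtosis x N ω - (8 + ∑ k, traceCoeff k * A k
      - ∑ k, ∑ l, quadCoeff k l * (D k * D l) + ∑ k, ∑ l, mixedCoeff k l * (D k * A l))|
      ≤ K * ((∑ k, |A k|) * (∑ k, |D k|) ^ 2 + (∑ k, |D k|) ^ 3 + N * (∑ k, |D k|) ^ 6) ∧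
    |mardiaKurtosis x N ω - (8 + ∑ k, traceCoeff k * A k)|
      ≤ K * ((∑ k, |A k|) * (∑ k, |D k|) + (∑ k, |D k|) ^ 2 + N * (∑ k, |D k|) ^ 6) := by
  obtain ⟨K, hK, H⟩ := exists_planarKurtosis_expansion_global
  -- The 3 reflects the crude bound `3 * hh` for the quartic averages recovered from the `A k`.
  refine ⟨3 * K, by positivity, fun {Ω x u v α β} hα hβ h0 h1 N ω hN D A hD hA => ?_⟩
  set r := ∑ k, |D k| with hr
  set hh := ∑ k, |A k| with hhh
  have hrk : ∀ k, |D k| ≤ r := fun k =>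
    Finset.single_le_sum (f := fun k => |D k|) (fun _ _ => abs_nonneg _) (Finset.mem_univ k)
  have hAk : ∀ k, |A k| ≤ hh := fun k =>
    Finset.single_le_sum (f := fun k => |A k|) (fun _ _ => abs_nonneg _) (Finset.mem_univ k)
  have hD' := fun k => (hD k).trans (avg_wickSq_linear (fun n => u n ω) (fun n => v n ω)
    (dirFst k) (dirSnd k) hN)
  have hA' := fun k => (hA k).trans (avg_wickFourth_linear (fun n => u n ω) (fun n => v n ω)
    (dirFst k) (dirSnd k) hN)
  obtain ⟨b0, b1⟩ := mardiaKurtosis_planar_bounds hα hβ h0 h1 N ω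
  have hB := mardiaKurtosis_eq_planarKurtosis hα hβ h0 h1 N ω
  generalize avg (fun n => u n ω ^ 2) N = P at *
  generalize avg (fun n => v n ω ^ 2) N = Q at *
  generalize avg (fun n => u n ω * v n ω) N = R at *
  generalize avg (fun n => u n ω ^ 4) N = m40 at *
  generalize avg (fun n => u n ω ^ 3 * v n ω) N = m31 at *
  generalize avg (fun n => u n ω ^ 2 * v n ω ^ 2) N = m22 at *
  generalize avg (fun n => u n ω * v n ω ^ 3) N = m13 at *
  generalize avg (fun n => v n ω ^ 4) N = m04 at *
  have d0 := hD' 0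
  have d1 := hD' 1
  have d2 := hD' 2
  have a0 := hA' 0
  have a1 := hA' 1
  have a2 := hA' 2
  have a3 := hA' 3
  have a4 := hA' 4
  simp only [dirFst, dirSnd, Matrix.cons_val] at d0 d1 d2 a0 a1 a2 a3 a4
  -- Inversion of the polarisation: `A 2 + A 3 = 2 h40 + 12 h22 + 2 h04`, `A 2 - A 3 = 8 (h31 +
  -- h13)` and `A 4 = h40 + 8 h31 + 24 h22 + 32 h13 + 16 h04`. The fifth direction only separates
  -- `h31` from `h13`; the leading terms involve just their sum, so its coefficients vanish.
  set h22 := (A 2 + A 3 - 2 * A 0 - 2 * A 1) / 12 with e22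
  set h13 := ((A 4 - A 0 - 24 * h22 - 16 * A 1) - (A 2 - A 3)) / 24 with e13
  set h31 := (A 2 - A 3) / 8 - h13 with e31
  set z := (D 2 - D 0 - D 1) / 2 with ez
  have c0 := abs_le.1 (hAk 0)
  have c1 := abs_le.1 (hAk 1)
  have c2 := abs_le.1 (hAk 2)
  have c3 := abs_le.1 (hAk 3)
  have c4 := abs_le.1 (hAk 4)
  have hh0 : 0 ≤ hh := (abs_nonneg _).trans (hAk 0)
  have hr0 : 0 ≤ r := (abs_nonneg _).trans (hrk 0)
  have f0 := abs_le.1 (le_refl |D 0|)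
  have f1 := abs_le.1 (le_refl |D 1|)
  have f2 := abs_le.1 (le_refl |D 2|)
  have f3 : |D 0| + |D 1| + |D 2| ≤ r := by
    rw [hr, Fin.sum_univ_five]
    linarith [abs_nonneg (D 3), abs_nonneg (D 4)]
  have hN1 : (1 : ℝ) ≤ N := by exact_mod_cast hN
  have r1 : P = 1 + D 0 := by linarith
  have r2 : Q = 1 + D 1 := by linarith
  have r3 : R = z := by linarith
  have r4 : m40 = A 0 + 6 * (1 + D 0) - 3 := by linarith
  have r5 : m04 = A 1 + 6 * (1 + D 1) - 3 := by linarith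
  have r6 : m22 = h22 + (1 + D 0) + (1 + D 1) - 1 := by linarith
  have r7 : m13 = h13 + 3 * z := by linarith
  have r8 : m31 = h31 + 3 * z := by linarith
  rw [r1, r2, r3, r4, r5, r6, r7, r8] at hB
  obtain ⟨g1, g2⟩ := H N (mardiaKurtosis x N ω) r (3 * hh) (D 0) (D 1) z (A 0) h31 h22 h13 (A 1)
    hN1 b0 b1 (hrk 0) (hrk 1) (abs_le.2 ⟨by linarith, by linarith⟩)
    (abs_le.2 ⟨by linarith, by linarith⟩) (abs_le.2 ⟨by linarith, by linarith⟩)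
    (abs_le.2 ⟨by linarith, by linarith⟩) (abs_le.2 ⟨by linarith, by linarith⟩)
    (abs_le.2 ⟨by linarith, by linarith⟩) fun _ => hB
  have t1 : ∑ k, traceCoeff k * A k = A 0 + 2 * h22 + A 1 := by
    simp only [Fin.sum_univ_five, traceCoeff, Matrix.cons_val, e22]; ring
  have t2 : ∑ k, ∑ l, quadCoeff k l * (D k * D l) = quadTerm (D 0) (D 1) z := by
    simp only [Fin.sum_univ_five, quadCoeff, Matrix.cons_val, ez, quadTerm]; ring
  have t3 : ∑ k, ∑ l, mixedCoeff k l * (D k * A l)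
      = mixedTerm (D 0) (D 1) z (A 0) h31 h22 h13 (A 1) := by
    simp only [Fin.sum_univ_five, mixedCoeff, Matrix.cons_val, ez, mixedTerm, e31, e22]; ring
  rw [t1, t2, t3]
  have p1 : 0 ≤ r ^ 3 := by positivity
  have p2 : 0 ≤ r ^ 2 := by positivity
  have p3 : 0 ≤ (N : ℝ) * r ^ 6 := by positivity
  constructor
  · refine g1.trans ?_
    calc _ ≤ K * (3 * (hh * r ^ 2 + r ^ 3 + N * r ^ 6)) :=
          mul_le_mul_of_nonneg_left (by linarith) hK
      _ = _ := by ring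
  · refine g2.trans ?_
    calc _ ≤ K * (3 * (hh * r + r ^ 2 + N * r ^ 6)) :=
          mul_le_mul_of_nonneg_left (by linarith) hK
      _ = _ := by ring

end Directions

/-! ### Whitening the time embedding -/

section Whitening

variable {Ω : Type*} [MeasurableSpace Ω] {μ : Measure Ω}
  {y : ℤ → Ω → ℝ} {C : ℤ → ℝ} {δ : ℕ}

lemma integral_mul_eq_lag (hC : ∀ k τ : ℤ, ∫ ω, y k ω * y (k - τ) ω ∂μ = C τ) (i j : ℤ) :
    ∫ ω, y i ω * y j ω ∂μ = C (i - j) := by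
  have := hC i (i - j)
  rwa [sub_sub_cancel] at this

lemma autocorrelation_neg (hC : ∀ k τ : ℤ, ∫ ω, y k ω * y (k - τ) ω ∂μ = C τ) (τ : ℤ) :
    C (-τ) = C τ := by
  have h1 := integral_mul_eq_lag hC 0 τ
  have h2 := integral_mul_eq_lag hC τ 0
  rw [zero_sub] at h1
  rw [sub_zero] at h2
  rw [← h1, ← h2]
  congr 1; ext ω; ring

/-- The second moments of `y 1 ± y 0` are `2 (C 0 ± C 1)`, so both factors of the determinant are
nonnegative, and neither vanishes. -/
lemma autocorrelation_pos (hgauss : IsGaussianProcess y μ)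
    (hC : ∀ k τ : ℤ, ∫ ω, y k ω * y (k - τ) ω ∂μ = C τ) (hdet : C 0 ^ 2 - C 1 ^ 2 ≠ 0) :
    0 < C 0 + C 1 ∧ 0 < C 0 - C 1 := by
  have my : ∀ k, HasAllMoments (y k) μ := fun k => (hgauss.hasGaussianLaw_eval k).hasAllMoments
  have h : ∀ s : ℝ, s ^ 2 = 1 → 0 ≤ C 0 + s * C 1 := fun s hs => by
    have e : ∫ ω, (y 1 ω + s * y 0 ω) ^ 2 ∂μ = 2 * (C 0 + s * C 1) := by
      have : ∀ ω, (y 1 ω + s * y 0 ω) ^ 2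
          = y 1 ω * y 1 ω + (2 * s) * (y 1 ω * y 0 ω) + y 0 ω * y 0 ω := fun ω => by
        linear_combination y 0 ω ^ 2 * hs
      simp_rw [this]
      rw [integral_add (((my 1).mul (my 1)).add (((my 1).mul (my 0)).const_mul _)).integrable
        ((my 0).mul (my 0)).integrable, integral_add ((my 1).mul (my 1)).integrable
        (((my 1).mul (my 0)).const_mul _).integrable, integral_const_mul, integral_mul_eq_lag hC,
        integral_mul_eq_lag hC, integral_mul_eq_lag hC]
      norm_num; ring
    have : 0 ≤ ∫ ω, (y 1 ω + s * y 0 ω) ^ 2 ∂μ := integral_nonneg fun ω => sq_nonneg _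
    linarith
  have h1 := h 1 (by norm_num)
  have h2 := h (-1) (by norm_num)
  have hne : (C 0 + C 1) * (C 0 - C 1) ≠ 0 := by
    intro h0; apply hdet; rw [← h0]; ring
  constructor
  · refine lt_of_le_of_ne (by linarith) fun h0 => hne (by rw [← h0]; ring)
  · refine lt_of_le_of_ne (by linarith) fun h0 => hne (by rw [← h0]; ring)

/-- The mixing condition in terms of the autocorrelation function, on all of `ℤ`. -/
lemma summable_autocorrelation_sq (hC : ∀ k τ : ℤ, ∫ ω, y k ω * y (k - τ) ω ∂μ = C τ)
    (hmix : IsMixing μ (timeEmbedding 2 δ y)) {i : ℤ} (hi : i = -1 ∨ i = 0 ∨ i = 1) :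
    Summable fun τ : ℤ => C (τ * δ + i) ^ 2 := by
  have key : ∀ a b : Fin 2, Summable fun τ : ℕ => C ((τ : ℤ) * δ + ((a : ℕ) - (b : ℕ))) ^ 2 :=
    fun a b => by
      refine (hmix a b).congr fun τ => ?_
      simp only [laggedCov, timeEmbedding, Matrix.of_apply, integral_mul_eq_lag hC, sq_abs]
      congr 2; ring
  have pos : ∀ i : ℤ, i = -1 ∨ i = 0 ∨ i = 1 → Summable fun τ : ℕ => C ((τ : ℤ) * δ + i) ^ 2 := by
    rintro i (rfl | rfl | rfl)
    · simpa using key 0 1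
    · simpa using key 0 0
    · simpa using key 1 0
  -- At negative lags evenness of `C` replaces `i` by `-i`, and the set of admissible shifts is
  -- symmetric.
  refine Summable.of_nat_of_neg (pos i hi) ?_
  have hi' : -i = -1 ∨ -i = 0 ∨ -i = 1 := by omega
  refine (pos (-i) hi').congr fun τ => ?_
  rw [← autocorrelation_neg hC]
  congr 2; ring

/-- Correlation functions of the whitened coordinates in the five directions. -/
noncomputable def dirCov (C : ℤ → ℝ) (δ : ℕ) (α β : ℝ) (k l : Fin 5) (τ : ℤ) : ℝ :=
  dirFst k * dirFst l * ((2 * C (τ * δ) + C (τ * δ + 1) + C (τ * δ - 1)) / (4 * α ^ 2))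
    + dirSnd k * dirSnd l * ((2 * C (τ * δ) - C (τ * δ + 1) - C (τ * δ - 1)) / (4 * β ^ 2))
    + (dirFst k * dirSnd l - dirSnd k * dirFst l)
      * ((C (τ * δ + 1) - C (τ * δ - 1)) / (4 * α * β))

/-- Sum and difference diagonalise a symmetric 2×2 matrix with equal diagonal entries, whatever `C`
is; `2 α²` and `2 β²` are its eigenvalues. At distinct times `u` and `v` may still be correlated,
which is the antisymmetric term of `dirCov`. -/
lemma isStationaryGaussianFamily_whitened (hgauss : IsGaussianProcess y μ)
    (hmean : ∀ k : ℤ, ∫ ω, y k ω ∂μ = 0)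
    (hC : ∀ k τ : ℤ, ∫ ω, y k ω * y (k - τ) ω ∂μ = C τ)
    (hmix : IsMixing μ (timeEmbedding 2 δ y)) {α β : ℝ} (hα0 : α ≠ 0) (hβ0 : β ≠ 0)
    (hα : α ^ 2 = (C 0 + C 1) / 2) (hβ : β ^ 2 = (C 0 - C 1) / 2) :
    IsStationaryGaussianFamily μ
      (fun (k : Fin 5) n ω => dirFst k * ((y (n * δ + 1) ω + y (n * δ + 2) ω) / (2 * α))
        + dirSnd k * ((y (n * δ + 1) ω - y (n * δ + 2) ω) / (2 * β))) (dirCov C δ α β) ∧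
    ∀ k, dirCov C δ α β k k 0 = dirFst k ^ 2 + dirSnd k ^ 2 := by
  have my : ∀ k, HasAllMoments (y k) μ := fun k => (hgauss.hasGaussianLaw_eval k).hasAllMoments
  set c₁ : Fin 5 → ℝ := fun k => dirFst k / (2 * α) + dirSnd k / (2 * β) with hc₁
  set c₂ : Fin 5 → ℝ := fun k => dirFst k / (2 * α) - dirSnd k / (2 * β) with hc₂
  have e : ∀ (k : Fin 5) (n : ℤ) ω, dirFst k * ((y (n * δ + 1) ω + y (n * δ + 2) ω) / (2 * α))
      + dirSnd k * ((y (n * δ + 1) ω - y (n * δ + 2) ω) / (2 * β))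
      = c₁ k * y (n * δ + 1) ω + c₂ k * y (n * δ + 2) ω := fun k n ω => by
    simp only [hc₁, hc₂]; ring
  have hdiag : ∀ k, dirCov C δ α β k k 0 = dirFst k ^ 2 + dirSnd k ^ 2 := fun k => by
    have h1 : C (-1) = C 1 := autocorrelation_neg hC 1
    have n1 : C 0 + C 1 ≠ 0 := fun h => hα0 (by rw [h] at hα; simpa using hα)
    have n2 : C 0 - C 1 ≠ 0 := fun h => hβ0 (by rw [h] at hβ; simpa using hβ)
    simp only [dirCov, zero_mul, zero_add, zero_sub, h1]
    rw [hα, hβ]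
    field_simp
    ring
  simp_rw [e]
  refine ⟨⟨?_, ?_, ?_, ?_, ?_⟩, hdiag⟩
  · refine hgauss.of_isGaussianProcess fun p => ⟨{p.2 * δ + 1, p.2 * δ + 2},
      c₁ p.1 • ContinuousLinearMap.proj (R := ℝ) (φ := fun _ => ℝ) ⟨p.2 * δ + 1, by simp⟩
      + c₂ p.1 • ContinuousLinearMap.proj (R := ℝ) (φ := fun _ => ℝ) ⟨p.2 * δ + 2, by simp⟩,
      fun ω => ?_⟩
    simp
  · intro k n
    rw [integral_add ((my _).const_mul _).integrable ((my _).const_mul _).integrable,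
      integral_const_mul, integral_const_mul, hmean, hmean]
    simp
  · intro k l s t
    have e2 : ∀ ω, (c₁ k * y (s * δ + 1) ω + c₂ k * y (s * δ + 2) ω)
        * (c₁ l * y (t * δ + 1) ω + c₂ l * y (t * δ + 2) ω)
        = (c₁ k * c₁ l) * (y (s * δ + 1) ω * y (t * δ + 1) ω)
          + (c₁ k * c₂ l) * (y (s * δ + 1) ω * y (t * δ + 2) ω)
          + (c₂ k * c₁ l) * (y (s * δ + 2) ω * y (t * δ + 1) ω)
          + (c₂ k * c₂ l) * (y (s * δ + 2) ω * y (t * δ + 2) ω) := fun ω => by ring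
    simp_rw [e2]
    have m := fun (i j : ℤ) (c : ℝ) => ((my i).mul (my j)).const_mul c
    rw [integral_add (((m _ _ _).add (m _ _ _)).add (m _ _ _)).integrable (m _ _ _).integrable,
      integral_add ((m _ _ _).add (m _ _ _)).integrable (m _ _ _).integrable,
      integral_add (m _ _ _).integrable (m _ _ _).integrable]
    simp only [integral_const_mul, integral_mul_eq_lag hC]
    have i1 : s * δ + 1 - (t * δ + 1) = (s - t) * (δ : ℤ) := by ring
    have i2 : s * δ + 1 - (t * δ + 2) = (s - t) * (δ : ℤ) - 1 := by ring
    have i3 : s * δ + 2 - (t * δ + 1) = (s - t) * (δ : ℤ) + 1 := by ring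
    have i4 : s * δ + 2 - (t * δ + 2) = (s - t) * (δ : ℤ) := by ring
    rw [i1, i2, i3, i4, dirCov]
    simp only [hc₁, hc₂]
    field_simp
    ring
  · intro k l
    have s0 := summable_autocorrelation_sq hC hmix (i := 0) (by simp)
    have s1 := summable_autocorrelation_sq hC hmix (i := 1) (by simp)
    have s2 := summable_autocorrelation_sq hC hmix (i := -1) (by simp)
    obtain ⟨p, q, w, h⟩ : ∃ p q w : ℝ, ∀ τ, dirCov C δ α β k l τ
        = p * C (τ * δ + 0) + q * C (τ * δ + 1) + w * C (τ * δ + -1) :=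
      ⟨dirFst k * dirFst l * 2 / (4 * α ^ 2) + dirSnd k * dirSnd l * 2 / (4 * β ^ 2),
        dirFst k * dirFst l / (4 * α ^ 2) - dirSnd k * dirSnd l / (4 * β ^ 2)
          + (dirFst k * dirSnd l - dirSnd k * dirFst l) / (4 * α * β),
        dirFst k * dirFst l / (4 * α ^ 2) - dirSnd k * dirSnd l / (4 * β ^ 2)
          - (dirFst k * dirSnd l - dirSnd k * dirFst l) / (4 * α * β),
        fun τ => by rw [dirCov, add_zero, ← sub_eq_add_neg]; ring⟩
    refine Summable.of_nonneg_of_le (fun τ => sq_nonneg _) (fun τ => ?_)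
      (((s0.mul_left (3 * p ^ 2)).add (s1.mul_left (3 * q ^ 2))).add (s2.mul_left (3 * w ^ 2)))
    rw [h]
    nlinarith [sq_nonneg (p * C (τ * δ + 0) - q * C (τ * δ + 1)),
      sq_nonneg (p * C (τ * δ + 0) - w * C (τ * δ + -1)),
      sq_nonneg (q * C (τ * δ + 1) - w * C (τ * δ + -1))]
  · intro k
    rw [hdiag]
    fin_cases k <;> norm_num [dirFst, dirSnd]

end Whitening

/-! ### Identification of the lag sums with `q₁` and `q₂` -/

section LagAverages

lemma lagAvg_add (f g : ℤ → ℝ) (N : ℕ) :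
    lagAvg (fun τ => f τ + g τ) N = lagAvg f N + lagAvg g N := by
  simp only [lagAvg, Finset.sum_add_distrib, mul_add]

lemma lagAvg_const_mul (c : ℝ) (f : ℤ → ℝ) (N : ℕ) :
    lagAvg (fun τ => c * f τ) N = c * lagAvg f N := by
  simp only [lagAvg, ← Finset.mul_sum]; ring

lemma lagAvg_sum {ι : Type*} (s : Finset ι) (f : ι → ℤ → ℝ) (N : ℕ) :
    lagAvg (fun τ => ∑ i ∈ s, f i τ) N = ∑ i ∈ s, lagAvg (f i) N := by
  classical
  induction s using Finset.induction_on with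
  | empty => simp [lagAvg]
  | insert a s ha ih => simp only [Finset.sum_insert ha, lagAvg_add, ih]

lemma lagAvg_eq (f : ℤ → ℝ) {N : ℕ} (hN : 1 ≤ N) :
    lagAvg f N = f 0 / N
      + 1 / (N : ℝ) ^ 2 * ∑ τ ∈ Finset.Icc 1 (N - 1), ((N : ℝ) - τ) * (f τ + f (-τ)) := by
  have hN0 : (N : ℝ) ≠ 0 := by positivity
  rw [lagAvg, sum_sum_lag_eq, mul_add]
  congr 1
  field_simp

variable {C : ℤ → ℝ} {δ : ℕ} {α β : ℝ}

/-- `U` and `V` are the lagged autocovariances of `u` and `v`, even in the lag, and `W` is their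
cross-covariance, odd in the lag. The sum is even in `W`, so the lags `τ` and `-τ` contribute
equally. At lag zero `U = V = 1` and `W = 0`. -/
lemma sum_trace_dirCov (hC : ∀ τ, C (-τ) = C τ) (hα0 : α ≠ 0) (hβ0 : β ≠ 0)
    (hα : α ^ 2 = (C 0 + C 1) / 2) (hβ : β ^ 2 = (C 0 - C 1) / 2) :
    (∑ k, ∑ l, traceCoeff k * traceCoeff l * (24 * dirCov C δ α β k l 0 ^ 4) = 64) ∧
    ∀ τ : ℕ, (∑ k, ∑ l, traceCoeff k * traceCoeff l * (24 * dirCov C δ α β k l τ ^ 4))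
      + ∑ k, ∑ l, traceCoeff k * traceCoeff l * (24 * dirCov C δ α β k l (-τ) ^ 4)
      = 16 * q₂ C δ τ / (C 0 ^ 2 - C 1 ^ 2) ^ 4 := by
  have expand : ∀ U V W : ℝ, ∑ k, ∑ l, traceCoeff k * traceCoeff l *
      (24 * (dirFst k * dirFst l * U + dirSnd k * dirSnd l * V
        + (dirFst k * dirSnd l - dirSnd k * dirFst l) * W) ^ 4)
      = 24 * U ^ 4 + 24 * V ^ 4 + 16 * U ^ 2 * V ^ 2 + 96 * (U ^ 2 + V ^ 2) * W ^ 2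
        - 64 * U * V * W ^ 2 + 64 * (W ^ 2) ^ 2 := fun U V W => by
    simp only [Fin.sum_univ_five, traceCoeff, dirFst, dirSnd, Matrix.cons_val]
    ring
  have n1 : C 0 + C 1 ≠ 0 := fun h => hα0 (by rw [h] at hα; simpa using hα)
  have n2 : C 0 - C 1 ≠ 0 := fun h => hβ0 (by rw [h] at hβ; simpa using hβ)
  have n3 : C 0 ^ 2 - C 1 ^ 2 = (C 0 + C 1) * (C 0 - C 1) := by ring
  simp only [dirCov, expand]
  constructor
  · have h1 : C (-1) = C 1 := hC 1
    simp only [zero_mul, zero_add, zero_sub, h1, sub_self, zero_div, hα, hβ]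
    field_simp
    ring
  · intro τ
    have g0 : C (-(τ : ℤ) * δ) = C (τ * δ) := by rw [← hC]; congr 1; ring
    have g1 : C (-(τ : ℤ) * δ + 1) = C (τ * δ - 1) := by rw [← hC]; congr 1; ring
    have g2 : C (-(τ : ℤ) * δ - 1) = C (τ * δ + 1) := by rw [← hC]; congr 1; ring
    rw [g0, g1, g2, q₂]
    simp only [gammaCoeff, add_zero, ← sub_eq_add_neg, q₂Poly, n3]
    generalize C (τ * δ) = c
    generalize C (τ * δ + 1) = p
    generalize C (τ * δ - 1) = m
    simp only [div_pow, mul_pow, hα, hβ]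
    generalize C 0 = a at *
    generalize C 1 = b at *
    field_simp
    ring

lemma sum_quad_dirCov (hC : ∀ τ, C (-τ) = C τ) (hα0 : α ≠ 0) (hβ0 : β ≠ 0)
    (hα : α ^ 2 = (C 0 + C 1) / 2) (hβ : β ^ 2 = (C 0 - C 1) / 2) :
    (∑ k, ∑ l, quadCoeff k l * (2 * dirCov C δ α β k l 0 ^ 2) = 16) ∧
    ∀ τ : ℕ, (∑ k, ∑ l, quadCoeff k l * (2 * dirCov C δ α β k l τ ^ 2))
      + ∑ k, ∑ l, quadCoeff k l * (2 * dirCov C δ α β k l (-τ) ^ 2)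
      = 4 * q₁ C δ τ / (C 0 ^ 2 - C 1 ^ 2) ^ 2 := by
  have expand : ∀ U V W : ℝ, ∑ k, ∑ l, quadCoeff k l *
      (2 * (dirFst k * dirFst l * U + dirSnd k * dirSnd l * V
        + (dirFst k * dirSnd l - dirSnd k * dirFst l) * W) ^ 2)
      = 6 * U ^ 2 + 6 * V ^ 2 + 4 * U * V + 8 * (U - V) * W := fun U V W => by
    simp only [Fin.sum_univ_five, quadCoeff, dirFst, dirSnd, Matrix.cons_val]
    ring
  have n1 : C 0 + C 1 ≠ 0 := fun h => hα0 (by rw [h] at hα; simpa using hα)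
  have n2 : C 0 - C 1 ≠ 0 := fun h => hβ0 (by rw [h] at hβ; simpa using hβ)
  have n3 : C 0 ^ 2 - C 1 ^ 2 = (C 0 + C 1) * (C 0 - C 1) := by ring
  simp only [dirCov, expand]
  constructor
  · have h1 : C (-1) = C 1 := hC 1
    simp only [zero_mul, zero_add, zero_sub, h1, sub_self, zero_div, hα, hβ]
    field_simp
    ring
  · intro τ
    have g0 : C (-(τ : ℤ) * δ) = C (τ * δ) := by rw [← hC]; congr 1; ring
    have g1 : C (-(τ : ℤ) * δ + 1) = C (τ * δ - 1) := by rw [← hC]; congr 1; ring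
    have g2 : C (-(τ : ℤ) * δ - 1) = C (τ * δ + 1) := by rw [← hC]; congr 1; ring
    rw [g0, g1, g2, q₁]
    simp only [gammaCoeff, add_zero, ← sub_eq_add_neg, q₁Poly, n3]
    generalize C (τ * δ) = c
    generalize C (τ * δ + 1) = p
    generalize C (τ * δ - 1) = m
    -- `quadCoeff` is not symmetric, which leaves a term linear in `W`; being odd in the lag, it
    -- cancels between `τ` and `-τ`.
    have cancel : ∀ U V W W' : ℝ, W' = -W →
        6 * U ^ 2 + 6 * V ^ 2 + 4 * U * V + 8 * (U - V) * W
          + (6 * U ^ 2 + 6 * V ^ 2 + 4 * U * V + 8 * (U - V) * W')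
        = 12 * U ^ 2 + 12 * V ^ 2 + 8 * U * V := fun U V W W' h => by rw [h]; ring
    rw [add_right_comm (2 * c) m p, sub_right_comm (2 * c) m p, cancel _ _ _ _ (by ring), hα, hβ]
    generalize C 0 = a at *
    generalize C 1 = b at *
    field_simp
    ring

end LagAverages

/-! ### Remainder moments and passage to mean and variance -/

section MomentEstimates

variable {Ω : Type*} [MeasurableSpace Ω] {μ : Measure Ω} [IsProbabilityMeasure μ]

omit [IsProbabilityMeasure μ] in
lemma integral_bilinear {f g : Fin 5 → Ω → ℝ} (hf : ∀ k, HasAllMoments (f k) μ)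
    (hg : ∀ k, HasAllMoments (g k) μ) (c : Fin 5 → Fin 5 → ℝ) :
    HasAllMoments (fun ω => ∑ k, ∑ l, c k l * (f k ω * g l ω)) μ ∧
    ∫ ω, ∑ k, ∑ l, c k l * (f k ω * g l ω) ∂μ = ∑ k, ∑ l, c k l * ∫ ω, f k ω * g l ω ∂μ := by
  have m : ∀ k l, HasAllMoments (fun ω => c k l * (f k ω * g l ω)) μ := fun k l =>
    ((hf k).mul (hg l)).const_mul _
  have m' : ∀ k, HasAllMoments (fun ω => ∑ l, c k l * (f k ω * g l ω)) μ := fun k =>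
    HasAllMoments.sum _ fun l _ => m k l
  refine ⟨HasAllMoments.sum _ fun k _ => m' k, ?_⟩
  rw [integral_finsetSum _ fun (k : Fin 5) _ => (m' k).integrable]
  refine Finset.sum_congr rfl fun k _ => ?_
  rw [integral_finsetSum _ fun (l : Fin 5) _ => (m k l).integrable]
  simp_rw [integral_const_mul]

/-- Even moments of a sum of absolute values are controlled by those of the terms. -/
lemma exists_integral_sum_abs_pow_le {f : Fin 5 → ℕ → Ω → ℝ}
    (hf : ∀ k N, HasAllMoments (f k N) μ) (m : ℕ) {b : ℕ → ℝ}
    (h : ∀ k, ∃ K : ℝ, 0 ≤ K ∧ ∀ N : ℕ, 1 ≤ N → ∫ ω, f k N ω ^ (2 * m) ∂μ ≤ K * b N) :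
    ∃ K : ℝ, 0 ≤ K ∧ ∀ N : ℕ, 1 ≤ N → ∫ ω, (∑ k, |f k N ω|) ^ (2 * m) ∂μ ≤ K * b N := by
  choose K hK H using h
  refine ⟨5 ^ (2 * m) * ∑ k, K k, mul_nonneg (by positivity) (Finset.sum_nonneg fun k _ => hK k),
    fun N hN => ?_⟩
  have hpt : ∀ ω, (∑ k, |f k N ω|) ^ (2 * m) ≤ 5 ^ (2 * m) * ∑ k, f k N ω ^ (2 * m) := fun ω => by
    have := Real.pow_arith_mean_le_arith_mean_pow Finset.univ (fun _ : Fin 5 => (1 / 5 : ℝ))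
      (fun k => |f k N ω|) (fun _ _ => by norm_num) (by simp) (fun _ _ => abs_nonneg _) (2 * m)
    simp only [← Finset.mul_sum, (even_two_mul m).pow_abs, mul_pow] at this
    have h0 : 0 ≤ ∑ k, f k N ω ^ (2 * m) :=
      Finset.sum_nonneg fun k _ => (even_two_mul m).pow_nonneg _
    calc _ = 5 ^ (2 * m) * ((1 / 5) ^ (2 * m) * (∑ k, |f k N ω|) ^ (2 * m)) := by
          rw [← mul_assoc, ← mul_pow]; norm_num
      _ ≤ 5 ^ (2 * m) * ∑ k, f k N ω ^ (2 * m) := by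
          gcongr
          linarith
  calc _ ≤ ∫ ω, 5 ^ (2 * m) * ∑ k, f k N ω ^ (2 * m) ∂μ :=
        integral_mono ((HasAllMoments.sum _ fun k _ => (hf k N).abs).pow _).integrable
          ((HasAllMoments.sum _ fun k _ => (hf k N).pow _).const_mul _).integrable hpt
    _ = 5 ^ (2 * m) * ∑ k, ∫ ω, f k N ω ^ (2 * m) ∂μ := by
        rw [integral_const_mul, integral_finsetSum _ fun k _ => ((hf k N).pow _).integrable]
    _ ≤ 5 ^ (2 * m) * ∑ k, K k * b N := by
        gcongr with k _
        exact H k N hN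
    _ = _ := by rw [← Finset.sum_mul]; ring

/-- Bounds for the error terms of the expansion; `e` stands for `N ^ (-1/4)`. -/
lemma integral_error_terms_le {h r : Ω → ℝ} (mh : HasAllMoments h μ) (mr : HasAllMoments r μ)
    {K e w : ℝ} (hK : 0 ≤ K) (he : 0 < e) (he1 : e ≤ 1) (hew : e * w = 1)
    (h2 : ∫ ω, h ω ^ 2 ∂μ ≤ K * e ^ 4) (h4 : ∫ ω, h ω ^ 4 ∂μ ≤ K)
    (r2 : ∫ ω, r ω ^ 2 ∂μ ≤ K * e ^ 4) (r4 : ∫ ω, r ω ^ 4 ∂μ ≤ K * e ^ 8)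
    (r6 : ∫ ω, r ω ^ 6 ∂μ ≤ K * e ^ 12) (r8 : ∫ ω, r ω ^ 8 ∂μ ≤ K * e ^ 16)
    (r12 : ∫ ω, r ω ^ 12 ∂μ ≤ K * e ^ 24) :
    ∫ ω, (h ω * r ω ^ 2 + r ω ^ 3 + w ^ 4 * r ω ^ 6) ∂μ ≤ 5 * K * e ^ 6 ∧
    ∫ ω, (h ω * r ω + r ω ^ 2 + w ^ 4 * r ω ^ 6) ^ 2 ∂μ ≤ 15 * K * e ^ 6 := by
  have hw : 0 < w := by
    by_contra hn
    nlinarith [mul_nonneg he.le (sub_nonneg.2 (not_lt.1 hn))]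
  have ew : ∀ n m : ℕ, w ^ n * e ^ (n + m) = e ^ m := fun n m => by
    rw [pow_add, ← mul_assoc, ← mul_pow, mul_comm w, hew, one_pow, one_mul]
  have e86 : e ^ 8 ≤ e ^ 6 := pow_le_pow_of_le_one he.le he1 (by norm_num)
  have e166 : e ^ 16 ≤ e ^ 6 := pow_le_pow_of_le_one he.le he1 (by norm_num)
  have k86 := mul_le_mul_of_nonneg_left e86 hK
  have k166 := mul_le_mul_of_nonneg_left e166 hK
  constructor
  · have hpt : ∀ ω, h ω * r ω ^ 2 + r ω ^ 3 + w ^ 4 * r ω ^ 6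
        ≤ e ^ 2 * h ω ^ 2 + (2 * w ^ 2) * r ω ^ 4 + e ^ 2 * r ω ^ 2 + w ^ 4 * r ω ^ 6 := fun ω => by
      -- The weights `e` and `w = 1 / e` balance the two sides: both have mean of order `e^6`.
      have a1 : 2 * (h ω * r ω ^ 2) ≤ e ^ 2 * h ω ^ 2 + w ^ 2 * r ω ^ 4 := by
        have := sq_nonneg (e * h ω - w * r ω ^ 2)
        linear_combination this - 2 * (h ω * r ω ^ 2) * hew
      have a2 : 2 * r ω ^ 3 ≤ e ^ 2 * r ω ^ 2 + w ^ 2 * r ω ^ 4 := by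
        have := sq_nonneg (e * r ω - w * r ω ^ 2)
        linear_combination this - 2 * (r ω ^ 3) * hew
      have b1 : 0 ≤ e ^ 2 * h ω ^ 2 := by positivity
      have b2 : 0 ≤ e ^ 2 * r ω ^ 2 := by positivity
      have b3 : 0 ≤ w ^ 2 * r ω ^ 4 := by positivity
      linarith
    have m1 := (mh.pow 2).const_mul (e ^ 2)
    have m2 := (mr.pow 4).const_mul (2 * w ^ 2)
    have m3 := (mr.pow 2).const_mul (e ^ 2)
    have m4 := (mr.pow 6).const_mul (w ^ 4)
    refine (integral_mono ((((mh.mul (mr.pow 2)).add (mr.pow 3)).add m4).integrable)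
      (((m1.add m2).add m3).add m4).integrable hpt).trans ?_
    rw [integral_add ((m1.add m2).add m3).integrable m4.integrable,
      integral_add (m1.add m2).integrable m3.integrable, integral_add m1.integrable m2.integrable]
    simp only [integral_const_mul]
    have c1 := mul_le_mul_of_nonneg_left h2 (by positivity : 0 ≤ e ^ 2)
    have c2 := mul_le_mul_of_nonneg_left r4 (by positivity : 0 ≤ 2 * w ^ 2)
    have c3 := mul_le_mul_of_nonneg_left r2 (by positivity : 0 ≤ e ^ 2)
    have c4 := mul_le_mul_of_nonneg_left r6 (by positivity : 0 ≤ w ^ 4)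
    have f1 : 2 * w ^ 2 * (K * e ^ 8) = 2 * K * e ^ 6 := by linear_combination 2 * K * ew 2 6
    have f2 : w ^ 4 * (K * e ^ 12) = K * e ^ 8 := by linear_combination K * ew 4 8
    linarith [show e ^ 2 * (K * e ^ 4) = K * e ^ 6 by ring]
  · have hpt : ∀ ω, (h ω * r ω + r ω ^ 2 + w ^ 4 * r ω ^ 6) ^ 2
        ≤ (3 * e ^ 2) * h ω ^ 2 + (3 * e ^ 6) * h ω ^ 4 + (3 * w ^ 10) * r ω ^ 8
          + 3 * r ω ^ 4 + (3 * w ^ 8) * r ω ^ 12 := fun ω => by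
      have a0 : (h ω * r ω + r ω ^ 2 + w ^ 4 * r ω ^ 6) ^ 2
          ≤ 3 * ((h ω * r ω) ^ 2 + (r ω ^ 2) ^ 2 + (w ^ 4 * r ω ^ 6) ^ 2) := by
        nlinarith [sq_nonneg (h ω * r ω - r ω ^ 2), sq_nonneg (h ω * r ω - w ^ 4 * r ω ^ 6),
          sq_nonneg (r ω ^ 2 - w ^ 4 * r ω ^ 6)]
      have a1 : 2 * (h ω * r ω) ^ 2 ≤ e ^ 2 * h ω ^ 2 + w ^ 2 * (h ω ^ 2 * r ω ^ 4) := by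
        have := mul_nonneg (sq_nonneg (h ω)) (sq_nonneg (e - w * r ω ^ 2))
        linear_combination this - 2 * (h ω * r ω) ^ 2 * hew
      -- A second weighted inequality trades `h² r⁴` for `h⁴`, with weight `e^6`, and `r⁸`. Thus a
      -- bounded fourth moment of `h` is enough.
      have a2 : 2 * (w ^ 2 * (h ω ^ 2 * r ω ^ 4)) ≤ e ^ 6 * h ω ^ 4 + w ^ 10 * r ω ^ 8 := by
        have t := sq_nonneg (e ^ 3 * h ω ^ 2 - w ^ 5 * r ω ^ 4)
        have : w ^ 5 * e ^ 3 = w ^ 2 := by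
          rw [show w ^ 5 * e ^ 3 = w ^ 2 * (e * w) ^ 3 by ring, hew]; ring
        linear_combination t - 2 * (h ω ^ 2 * r ω ^ 4) * this
      have b1 : 0 ≤ e ^ 2 * h ω ^ 2 := by positivity
      have b2 : 0 ≤ e ^ 6 * h ω ^ 4 := by positivity
      have b3 : 0 ≤ w ^ 10 * r ω ^ 8 := by positivity
      linarith [show (r ω ^ 2) ^ 2 = r ω ^ 4 by ring,
        show (w ^ 4 * r ω ^ 6) ^ 2 = w ^ 8 * r ω ^ 12 by ring]
    have m1 := (mh.pow 2).const_mul (3 * e ^ 2)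
    have m2 := (mh.pow 4).const_mul (3 * e ^ 6)
    have m3 := (mr.pow 8).const_mul (3 * w ^ 10)
    have m4 := (mr.pow 4).const_mul 3
    have m5 := (mr.pow 12).const_mul (3 * w ^ 8)
    refine (integral_mono ((((mh.mul mr).add (mr.pow 2)).add
      ((mr.pow 6).const_mul (w ^ 4))).pow 2).integrable
      ((((m1.add m2).add m3).add m4).add m5).integrable hpt).trans ?_
    rw [integral_add (((m1.add m2).add m3).add m4).integrable m5.integrable,
      integral_add ((m1.add m2).add m3).integrable m4.integrable,
      integral_add (m1.add m2).integrable m3.integrable, integral_add m1.integrable m2.integrable]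
    simp only [integral_const_mul]
    have c1 := mul_le_mul_of_nonneg_left h2 (by positivity : 0 ≤ 3 * e ^ 2)
    have c2 := mul_le_mul_of_nonneg_left h4 (by positivity : 0 ≤ 3 * e ^ 6)
    have c3 := mul_le_mul_of_nonneg_left r8 (by positivity : 0 ≤ 3 * w ^ 10)
    have c5 := mul_le_mul_of_nonneg_left r12 (by positivity : 0 ≤ 3 * w ^ 8)
    have f1 : 3 * w ^ 10 * (K * e ^ 16) = 3 * K * e ^ 6 := by linear_combination 3 * K * ew 10 6
    have f2 : 3 * w ^ 8 * (K * e ^ 24) = 3 * K * e ^ 16 := by linear_combination 3 * K * ew 8 16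
    linarith [show 3 * e ^ 2 * (K * e ^ 4) = 3 * (K * e ^ 6) by ring]

/-- If `B` is close to `8 + T - q + m` in mean and to `8 + T` in mean square, where `T` and `m` are
centred, then its mean is close to `8 - E q` and its variance to `E T²`. -/
lemma mean_variance_estimates {B T q m E₁ E₂ : Ω → ℝ} (mB : MemLp B 2 μ)
    (mT : HasAllMoments T μ) (mq : HasAllMoments q μ) (mm : HasAllMoments m μ)
    (mE₁ : HasAllMoments E₁ μ) (mE₂ : HasAllMoments E₂ μ)
    (hT : ∫ ω, T ω ∂μ = 0) (hm : ∫ ω, m ω ∂μ = 0) {L K e w : ℝ} (hL : 0 ≤ L) (hK : 0 ≤ K)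
    (he : 0 < e) (he1 : e ≤ 1) (hew : e * w = 1)
    (b1 : ∀ ω, |B ω - (8 + T ω - q ω + m ω)| ≤ L * E₁ ω)
    (b2 : ∀ ω, |B ω - (8 + T ω)| ≤ L * E₂ ω)
    (i1 : ∫ ω, E₁ ω ∂μ ≤ K * e ^ 6) (i2 : ∫ ω, E₂ ω ^ 2 ∂μ ≤ K * e ^ 6)
    (iT : ∫ ω, T ω ^ 2 ∂μ ≤ K * e ^ 4) :
    |∫ ω, B ω ∂μ - (8 - ∫ ω, q ω ∂μ)| ≤ L * K * e ^ 6 ∧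
    |variance B μ - ∫ ω, T ω ^ 2 ∂μ| ≤ (K + 3 * (L ^ 2 * K)) * e ^ 5 := by
  have iB : Integrable B μ := mB.integrable (by norm_num)
  have hw : 0 < w := by
    by_contra hn
    nlinarith [mul_nonneg he.le (sub_nonneg.2 (not_lt.1 hn))]
  constructor
  · have hc : HasAllMoments (fun _ : Ω => (8 : ℝ)) μ := .const 8
    have e1 : ∫ ω, B ω ∂μ - (8 - ∫ ω, q ω ∂μ) = ∫ ω, B ω - (8 + T ω - q ω + m ω) ∂μ := by
      rw [integral_sub iB (((hc.add mT).sub mq).add mm).integrable,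
        integral_add ((hc.add mT).sub mq).integrable mm.integrable,
        integral_sub (hc.add mT).integrable mq.integrable,
        integral_add hc.integrable mT.integrable, hT, hm]
      simp
    rw [e1]
    calc _ ≤ ∫ ω, |B ω - (8 + T ω - q ω + m ω)| ∂μ := abs_integral_le_integral_abs
      _ ≤ ∫ ω, L * E₁ ω ∂μ := integral_mono
          (iB.sub (((hc.add mT).sub mq).add mm).integrable).abs (mE₁.const_mul L).integrable b1
      _ ≤ L * (K * e ^ 6) := by rw [integral_const_mul]; gcongr
      _ = _ := by ring
  · set ρ : Ω → ℝ := fun ω => B ω - (8 + T ω) with hρ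
    have mρ : MemLp ρ 2 μ := mB.sub (((HasAllMoments.const 8).add mT).memLp_two)
    have mTρ : Integrable (fun ω => T ω * ρ ω) μ := mT.memLp_two.integrable_mul mρ
    have hBρ : B = fun ω => 8 + (T ω + ρ ω) := by ext ω; simp only [hρ]; ring
    have hTρ : MemLp (fun ω => T ω + ρ ω) 2 μ := mT.memLp_two.add mρ
    have hvar : variance B μ = ∫ ω, T ω ^ 2 ∂μ + 2 * ∫ ω, T ω * ρ ω ∂μ + variance ρ μ := by
      have h1 : variance B μ = variance (fun ω => T ω + ρ ω) μ := by
        rw [hBρ]; exact variance_const_add hTρ.aestronglyMeasurable 8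
      have h2 : ∫ ω, T ω + ρ ω ∂μ = ∫ ω, ρ ω ∂μ := by
        rw [integral_add mT.integrable (mρ.integrable (by norm_num)), hT, zero_add]
      have h3 : ∫ ω, (T ω + ρ ω) ^ 2 ∂μ
          = ∫ ω, T ω ^ 2 ∂μ + 2 * ∫ ω, T ω * ρ ω ∂μ + ∫ ω, ρ ω ^ 2 ∂μ := by
        have : ∀ ω, (T ω + ρ ω) ^ 2 = T ω ^ 2 + 2 * (T ω * ρ ω) + ρ ω ^ 2 := fun ω => by ring
        simp_rw [this]
        have i12 : Integrable (fun ω => T ω ^ 2 + 2 * (T ω * ρ ω)) μ :=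
          (mT.pow 2).integrable.add (mTρ.const_mul 2)
        rw [integral_add i12 mρ.integrable_sq,
          integral_add (mT.pow 2).integrable (mTρ.const_mul 2), integral_const_mul]
      rw [h1, variance_eq_sub hTρ, variance_eq_sub mρ]
      simp only [Pi.pow_apply]
      rw [h2, h3]; ring
    have hρ2 : ∫ ω, ρ ω ^ 2 ∂μ ≤ L ^ 2 * K * e ^ 6 := by
      calc _ ≤ ∫ ω, L ^ 2 * E₂ ω ^ 2 ∂μ := by
            refine integral_mono mρ.integrable_sq ((mE₂.pow 2).const_mul _).integrable fun ω => ?_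
            have := pow_le_pow_left₀ (abs_nonneg _) (b2 ω) 2
            rwa [sq_abs, mul_pow] at this
        _ ≤ L ^ 2 * (K * e ^ 6) := by rw [integral_const_mul]; gcongr
        _ = _ := by ring
    have hvρ : variance ρ μ ≤ L ^ 2 * K * e ^ 6 := by
      refine le_trans ?_ hρ2
      rw [variance_eq_sub mρ]
      have := sq_nonneg (∫ ω, ρ ω ∂μ)
      simp only [Pi.pow_apply]
      linarith
    -- Weighted inequality `2 |T ρ| ≤ e T² + w ρ²`; this cross term sets the final rate `e^5 =
    -- N^(-5/4)`.
    have hcross : |2 * ∫ ω, T ω * ρ ω ∂μ| ≤ (K + L ^ 2 * K) * e ^ 5 := by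
      rw [← integral_const_mul]
      calc _ ≤ ∫ ω, |2 * (T ω * ρ ω)| ∂μ := abs_integral_le_integral_abs
        _ ≤ ∫ ω, e * T ω ^ 2 + w * ρ ω ^ 2 ∂μ := by
            refine integral_mono (mTρ.const_mul 2).abs (((mT.pow 2).const_mul e).integrable.add
              (mρ.integrable_sq.const_mul w)) fun ω => ?_
            have s1 := mul_nonneg hw.le (sq_nonneg (e * T ω - ρ ω))
            have s2 := mul_nonneg hw.le (sq_nonneg (e * T ω + ρ ω))
            have t1 : w * (e * T ω - ρ ω) ^ 2
                = e * T ω ^ 2 + w * ρ ω ^ 2 - 2 * (T ω * ρ ω) := by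
              linear_combination (e * T ω ^ 2 - 2 * T ω * ρ ω) * hew
            have t2 : w * (e * T ω + ρ ω) ^ 2
                = e * T ω ^ 2 + w * ρ ω ^ 2 + 2 * (T ω * ρ ω) := by
              linear_combination (e * T ω ^ 2 + 2 * T ω * ρ ω) * hew
            change |2 * (T ω * ρ ω)| ≤ _
            rw [abs_le]
            constructor <;> linarith
        _ = e * ∫ ω, T ω ^ 2 ∂μ + w * ∫ ω, ρ ω ^ 2 ∂μ := by
            rw [integral_add ((mT.pow 2).const_mul e).integrable (mρ.integrable_sq.const_mul w),
              integral_const_mul, integral_const_mul]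
        _ ≤ e * (K * e ^ 4) + w * (L ^ 2 * K * e ^ 6) := by gcongr
        _ = _ := by linear_combination L ^ 2 * K * e ^ 5 * hew
    have e65 : e ^ 6 ≤ e ^ 5 := pow_le_pow_of_le_one he.le he1 (by norm_num)
    have hv0 := variance_nonneg ρ μ
    have k1 := mul_le_mul_of_nonneg_left e65 (by positivity : 0 ≤ L ^ 2 * K)
    have k2 : 0 ≤ L ^ 2 * K * e ^ 5 := by positivity
    rw [hvar]
    rw [abs_le] at hcross ⊢
    constructor <;> linarith

end MomentEstimates

/-! ### Conclusion: asymptotics of mean and variance -/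

lemma isLittleO_one_div_of_abs_le {f : ℕ → ℝ} {K : ℝ} (hf : ∀ N : ℕ, 1 ≤ N →
    |f N| ≤ K * ((N : ℝ) ^ (-(1 / 4) : ℝ)) ^ 5) : f =o[atTop] fun N : ℕ => 1 / (N : ℝ) := by
  have hO : f =O[atTop] fun N : ℕ => ((N : ℝ) ^ (-(1 / 4) : ℝ)) ^ 5 := by
    refine IsBigO.of_bound K ?_
    filter_upwards [eventually_ge_atTop 1] with N hN
    rw [Real.norm_eq_abs, Real.norm_of_nonneg (by positivity)]
    exact hf N hN
  have ht : (fun N : ℕ => (N : ℝ) ^ (-(1 / 4) : ℝ)) =o[atTop] fun _ => (1 : ℝ) :=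
    (isLittleO_one_iff ℝ).2
      ((tendsto_rpow_neg_atTop (by norm_num)).comp tendsto_natCast_atTop_atTop)
  refine hO.trans_isLittleO ((ht.mul_isBigO (isBigO_refl (fun N : ℕ => 1 / (N : ℝ)) atTop)).congr
    (fun N => ?_) fun N => one_mul _)
  have h4 : ((N : ℝ) ^ (-(1 / 4) : ℝ)) ^ 4 = 1 / (N : ℝ) := by
    rw [← Real.rpow_natCast, ← Real.rpow_mul (by positivity)]
    norm_num [Real.rpow_neg_one]
  rw [← h4]; ring

lemma memLp_mardiaKurtosis_planar {Ω : Type*} [MeasurableSpace Ω] {μ : Measure Ω}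
    [IsProbabilityMeasure μ] {x : ℤ → Ω → Fin 2 → ℝ} {u v : ℤ → Ω → ℝ} {α β : ℝ}
    (hα : α ≠ 0) (hβ : β ≠ 0) (hu : ∀ n, AEMeasurable (u n) μ) (hv : ∀ n, AEMeasurable (v n) μ)
    (h0 : ∀ n ω, x n ω 0 = α * u n ω + β * v n ω)
    (h1 : ∀ n ω, x n ω 1 = α * u n ω - β * v n ω) (N : ℕ) : MemLp (mardiaKurtosis x N) 2 μ := by
  refine MemLp.of_bound ?_ (4 * N) (ae_of_all _ fun ω => ?_)
  · have hm : ∀ f : ℤ → Ω → ℝ, (∀ n, AEMeasurable (f n) μ) →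
        AEMeasurable (fun ω => avg (fun n => f n ω) N) μ := fun f hf =>
      (Finset.aemeasurable_fun_sum _ fun (n : ℕ) _ => hf n).const_mul _
    have mP := hm (fun n ω => u n ω ^ 2) fun n => (hu n).pow_const 2
    have mQ := hm (fun n ω => v n ω ^ 2) fun n => (hv n).pow_const 2
    have mR := hm (fun n ω => u n ω * v n ω) fun n => (hu n).mul (hv n)
    have e : mardiaKurtosis x N = fun ω => _ := funext fun ω =>
      mardiaKurtosis_eq_avg hα hβ h0 h1 N ω
    rw [e]
    refine (hm (fun n ω => planarForm _ _ _ (u n ω) (v n ω) ^ 2) fun n => ?_).aestronglyMeasurable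
    have hun := hu n
    have hvn := hv n
    unfold planarForm
    fun_prop
  · obtain ⟨b0, b1⟩ := mardiaKurtosis_planar_bounds hα hβ h0 h1 N ω
    rwa [Real.norm_of_nonneg b0]

theorem mainTheorem3 {Ω : Type*} [MeasurableSpace Ω] (μ : Measure Ω) [IsProbabilityMeasure μ]
    (y : ℤ → Ω → ℝ) (C : ℤ → ℝ) (δ : ℕ) (hδ : 1 ≤ δ)
    (hgauss : IsGaussianProcess y μ)
    (hmean : ∀ k : ℤ, ∫ ω, y k ω ∂μ = 0)
    (hC : ∀ k τ : ℤ, ∫ ω, y k ω * y (k - τ) ω ∂μ = C τ)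
    (hdet : C 0 ^ 2 - C 1 ^ 2 ≠ 0)
    (hmix : IsMixing μ (timeEmbedding 2 δ y)) :
    (∀ N : ℕ, MemLp (mardiaKurtosis (timeEmbedding 2 δ y) N) 2 μ) ∧
    ((fun N : ℕ => (∫ ω, mardiaKurtosis (timeEmbedding 2 δ y) N ω ∂μ)
        - (8 - 16 / (N : ℝ)
            - 4 / (N : ℝ) ^ 2 * ∑ τ ∈ Finset.Icc 1 (N - 1),
                ((N : ℝ) - (τ : ℝ)) * q₁ C δ τ / (C 0 ^ 2 - C 1 ^ 2) ^ 2))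
      =o[atTop] fun N : ℕ => 1 / (N : ℝ)) ∧
    ((fun N : ℕ => variance (mardiaKurtosis (timeEmbedding 2 δ y) N) μ
        - (64 / (N : ℝ)
            + 16 / (N : ℝ) ^ 2 * ∑ τ ∈ Finset.Icc 1 (N - 1),
                ((N : ℝ) - (τ : ℝ)) * q₂ C δ τ / (C 0 ^ 2 - C 1 ^ 2) ^ 4))
      =o[atTop] fun N : ℕ => 1 / (N : ℝ)) := by
  obtain ⟨p1, p2⟩ := autocorrelation_pos hgauss hC hdet
  have hCneg := autocorrelation_neg hC
  obtain ⟨α, hα0, hα⟩ : ∃ α : ℝ, α ≠ 0 ∧ α ^ 2 = (C 0 + C 1) / 2 :=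
    ⟨√((C 0 + C 1) / 2), by positivity, Real.sq_sqrt (by positivity)⟩
  obtain ⟨β, hβ0, hβ⟩ : ∃ β : ℝ, β ≠ 0 ∧ β ^ 2 = (C 0 - C 1) / 2 :=
    ⟨√((C 0 - C 1) / 2), by positivity, Real.sq_sqrt (by positivity)⟩
  set u : ℤ → Ω → ℝ := fun n ω => (y (n * δ + 1) ω + y (n * δ + 2) ω) / (2 * α) with hu
  set v : ℤ → Ω → ℝ := fun n ω => (y (n * δ + 1) ω - y (n * δ + 2) ω) / (2 * β) with hv
  set x := timeEmbedding 2 δ y with hx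
  have hx0 : ∀ n ω, x n ω 0 = α * u n ω + β * v n ω := fun n ω => by
    simp only [hx, timeEmbedding, hu, hv, Fin.val_zero, Nat.cast_zero, add_zero]
    field_simp; ring
  have hx1 : ∀ n ω, x n ω 1 = α * u n ω - β * v n ω := fun n ω => by
    simp only [hx, timeEmbedding, hu, hv, Fin.val_one, Nat.cast_one, add_assoc, one_add_one_eq_two]
    field_simp; ring
  obtain ⟨hfam, hdiag⟩ := isStationaryGaussianFamily_whitened hgauss hmean hC hmix hα0 hβ0 hα hβ
  set g : Fin 5 → ℤ → Ω → ℝ := fun k n ω => dirFst k * u n ω + dirSnd k * v n ω with hg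
  set r := dirCov C δ α β with hr
  have my : ∀ k, AEMeasurable (y k) μ := hgauss.aemeasurable
  have hmem : ∀ N : ℕ, MemLp (mardiaKurtosis x N) 2 μ := memLp_mardiaKurtosis_planar hα0 hβ0
    (fun n => ((my _).add (my _)).div_const _) (fun n => ((my _).sub (my _)).div_const _) hx0 hx1
  set D : Fin 5 → ℕ → Ω → ℝ := fun k N ω => avg (fun n => wickSq (r k k 0) (g k n ω)) N with hD
  set A : Fin 5 → ℕ → Ω → ℝ := fun k N ω => avg (fun n => wickFourth (r k k 0) (g k n ω)) N with hA
  have mD : ∀ k N, HasAllMoments (D k N) μ := fun k N =>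
    HasAllMoments.avg (fun n => (hfam.hasAllMoments k n).wickSq _) N
  have mA : ∀ k N, HasAllMoments (A k N) μ := fun k N =>
    HasAllMoments.avg (fun n => (hfam.hasAllMoments k n).wickFourth _) N
  obtain ⟨L, hL, hexp⟩ := exists_mardiaKurtosis_expansion
  have hexp' := fun N hN ω => hexp hα0 hβ0 hx0 hx1 N ω hN (fun k => D k N ω) (fun k => A k N ω)
    (fun k => by simp only [hD, hdiag]; rfl) (fun k => by simp only [hA, hdiag]; rfl)
  have hDm := fun m => exists_integral_sum_abs_pow_le mD m
    (b := fun N => (1 / (N : ℝ)) ^ m) fun k => hfam.exists_integral_avg_wickSq_pow_le k m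
  obtain ⟨K1, hK1, D2⟩ := hDm 1
  obtain ⟨K2, hK2, D4⟩ := hDm 2
  obtain ⟨K3, hK3, D6⟩ := hDm 3
  obtain ⟨K4, hK4, D8⟩ := hDm 4
  obtain ⟨K6, hK6, D12⟩ := hDm 6
  obtain ⟨K7, hK7, A2⟩ := exists_integral_sum_abs_pow_le mA 1 (b := fun N => 1 / (N : ℝ))
    fun k => hfam.exists_integral_avg_wickFourth_sq_le k
  obtain ⟨K8, hK8, A4⟩ := exists_integral_sum_abs_pow_le mA 2 (b := fun _ => 1) fun k => by
    obtain ⟨K, hK, H⟩ := hfam.exists_integral_avg_wickFourth_pow_four_le k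
    exact ⟨K, hK, fun N _ => by simpa using H N⟩
  set K := K1 + K2 + K3 + K4 + K6 + K7 + K8 with hKdef
  have hK : 0 ≤ K := by positivity
  obtain ⟨f0, fτ⟩ := sum_quad_dirCov (δ := δ) hCneg hα0 hβ0 hα hβ
  obtain ⟨t0, tτ⟩ := sum_trace_dirCov (δ := δ) hCneg hα0 hβ0 hα hβ
  rw [← hr] at f0 fτ t0 tτ
  have main : ∀ N : ℕ, 1 ≤ N →
      |(∫ ω, mardiaKurtosis x N ω ∂μ) - (8 - 16 / (N : ℝ)
        - 4 / (N : ℝ) ^ 2 * ∑ τ ∈ Finset.Icc 1 (N - 1),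
          ((N : ℝ) - (τ : ℝ)) * q₁ C δ τ / (C 0 ^ 2 - C 1 ^ 2) ^ 2)|
        ≤ L * (15 * K) * ((N : ℝ) ^ (-(1 / 4) : ℝ)) ^ 5 ∧
      |variance (mardiaKurtosis x N) μ - (64 / (N : ℝ)
        + 16 / (N : ℝ) ^ 2 * ∑ τ ∈ Finset.Icc 1 (N - 1),
          ((N : ℝ) - (τ : ℝ)) * q₂ C δ τ / (C 0 ^ 2 - C 1 ^ 2) ^ 4)|
        ≤ (15 * K + 3 * (L ^ 2 * (15 * K))) * ((N : ℝ) ^ (-(1 / 4) : ℝ)) ^ 5 := by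
    intro N hN
    have hN1 : (1 : ℝ) ≤ N := by exact_mod_cast hN
    have hN0 : (0 : ℝ) < N := by linarith
    set e : ℝ := (N : ℝ) ^ (-(1 / 4) : ℝ) with he_def
    have he : 0 < e := by positivity
    have he1 : e ≤ 1 := Real.rpow_le_one_of_one_le_of_nonpos hN1 (by norm_num)
    have e4 : 1 / (N : ℝ) = e ^ 4 := by
      rw [he_def, ← Real.rpow_natCast, ← Real.rpow_mul (by positivity)]
      norm_num [Real.rpow_neg_one]
    set w := e⁻¹ with hw
    have hew : e * w = 1 := mul_inv_cancel₀ he.ne'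
    have w4 : w ^ 4 = N := by rw [hw, inv_pow, ← e4]; simp
    have mh : HasAllMoments (fun ω => ∑ k, |A k N ω|) μ :=
      HasAllMoments.sum _ fun k _ => (mA k N).abs
    have mr : HasAllMoments (fun ω => ∑ k, |D k N ω|) μ :=
      HasAllMoments.sum _ fun k _ => (mD k N).abs
    have up : ∀ {a Ki : ℝ} (n : ℕ), a ≤ Ki * e ^ n → Ki ≤ K → a ≤ K * e ^ n :=
      fun n h1 h2 => h1.trans (by gcongr)
    have hA2 : ∫ ω, (∑ k, |A k N ω|) ^ 2 ∂μ ≤ K * e ^ 4 :=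
      up 4 (e4 ▸ A2 N hN) (by linarith)
    have pw : ∀ m : ℕ, (1 / (N : ℝ)) ^ m = e ^ (4 * m) := fun m => by rw [e4, pow_mul]
    obtain ⟨i1, i2⟩ := integral_error_terms_le mh mr hK he he1 hew hA2
      ((A4 N hN).trans (by linarith))
      (up 4 (pw 1 ▸ D2 N hN) (by linarith)) (up 8 (pw 2 ▸ D4 N hN) (by linarith))
      (up 12 (pw 3 ▸ D6 N hN) (by linarith)) (up 16 (pw 4 ▸ D8 N hN) (by linarith))
      (up 24 (pw 6 ▸ D12 N hN) (by linarith))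
    have mT : HasAllMoments (fun ω => ∑ k, traceCoeff k * A k N ω) μ :=
      HasAllMoments.sum _ fun k _ => (mA k N).const_mul _
    have hT0 : ∫ ω, ∑ k, traceCoeff k * A k N ω ∂μ = 0 := by
      rw [integral_finsetSum _ fun k _ => ((mA k N).const_mul _).integrable]
      refine Finset.sum_eq_zero fun k _ => ?_
      rw [integral_const_mul, hfam.integral_avg_wickFourth k N, mul_zero]
    obtain ⟨mq, iq⟩ := integral_bilinear (fun k => mD k N) (fun k => mD k N) quadCoeff
    obtain ⟨mm, im⟩ := integral_bilinear (fun k => mD k N) (fun k => mA k N) mixedCoeff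
    have hm0 : ∫ ω, ∑ k, ∑ l, mixedCoeff k l * (D k N ω * A l N ω) ∂μ = 0 := by
      rw [im]
      refine Finset.sum_eq_zero fun k _ => Finset.sum_eq_zero fun l _ => ?_
      rw [(hfam.integral_avg_wick k l N).2.1, mul_zero]
    have hq : ∫ ω, ∑ k, ∑ l, quadCoeff k l * (D k N ω * D l N ω) ∂μ
        = 16 / (N : ℝ) + 4 / (N : ℝ) ^ 2 * ∑ τ ∈ Finset.Icc 1 (N - 1),
          ((N : ℝ) - (τ : ℝ)) * q₁ C δ τ / (C 0 ^ 2 - C 1 ^ 2) ^ 2 := by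
      have : ∫ ω, ∑ k, ∑ l, quadCoeff k l * (D k N ω * D l N ω) ∂μ
          = lagAvg (fun τ => ∑ k, ∑ l, quadCoeff k l * (2 * r k l τ ^ 2)) N := by
        rw [iq, lagAvg_sum]
        refine Finset.sum_congr rfl fun k _ => ?_
        rw [lagAvg_sum]
        refine Finset.sum_congr rfl fun l _ => ?_
        rw [lagAvg_const_mul, (hfam.integral_avg_wick k l N).1]
      rw [this, lagAvg_eq _ hN, f0]
      congr 1
      rw [Finset.mul_sum, Finset.mul_sum]
      refine Finset.sum_congr rfl fun τ _ => ?_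
      rw [fτ τ]
      ring
    have hTT : ∫ ω, (∑ k, traceCoeff k * A k N ω) ^ 2 ∂μ
        = 64 / (N : ℝ) + 16 / (N : ℝ) ^ 2 * ∑ τ ∈ Finset.Icc 1 (N - 1),
          ((N : ℝ) - (τ : ℝ)) * q₂ C δ τ / (C 0 ^ 2 - C 1 ^ 2) ^ 4 := by
      have : ∫ ω, (∑ k, traceCoeff k * A k N ω) ^ 2 ∂μ = lagAvg (fun τ =>
          ∑ k, ∑ l, traceCoeff k * traceCoeff l * (24 * r k l τ ^ 4)) N := by
        have hsq : ∀ ω, (∑ k, traceCoeff k * A k N ω) ^ 2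
            = ∑ k, ∑ l, (traceCoeff k * traceCoeff l) * (A k N ω * A l N ω) := fun ω => by
          rw [sq, Finset.sum_mul_sum]
          exact Finset.sum_congr rfl fun k _ => Finset.sum_congr rfl fun l _ => by ring
        simp_rw [hsq]
        rw [(integral_bilinear (fun k => mA k N) (fun k => mA k N)
          fun k l => traceCoeff k * traceCoeff l).2, lagAvg_sum]
        refine Finset.sum_congr rfl fun k _ => ?_
        rw [lagAvg_sum]
        refine Finset.sum_congr rfl fun l _ => ?_
        rw [lagAvg_const_mul, (hfam.integral_avg_wick k l N).2.2]
      rw [this, lagAvg_eq _ hN, t0]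
      congr 1
      rw [Finset.mul_sum, Finset.mul_sum]
      refine Finset.sum_congr rfl fun τ _ => ?_
      rw [tτ τ]
      ring
    have iT : ∫ ω, (∑ k, traceCoeff k * A k N ω) ^ 2 ∂μ ≤ 15 * K * e ^ 4 := by
      -- All trace coefficients have absolute value at most one, so `T` is dominated by `∑ |A k|`.
      have h1 : ∫ ω, (∑ k, traceCoeff k * A k N ω) ^ 2 ∂μ ≤ ∫ ω, (∑ k, |A k N ω|) ^ 2 ∂μ := by
        refine integral_mono (mT.pow 2).integrable (mh.pow 2).integrable fun ω => ?_
        refine sq_le_sq.2 ?_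
        rw [abs_of_nonneg (Finset.sum_nonneg fun k _ => abs_nonneg (A k N ω) :
          0 ≤ ∑ k, |A k N ω|)]
        refine (Finset.abs_sum_le_sum_abs _ _).trans (Finset.sum_le_sum fun k _ => ?_)
        rw [abs_mul]
        refine mul_le_of_le_one_left (abs_nonneg _) ?_
        fin_cases k <;> norm_num [traceCoeff, abs_le]
      have h2 : 0 ≤ K * e ^ 4 := by positivity
      linarith
    have mE₁ : HasAllMoments (fun ω => (∑ k, |A k N ω|) * (∑ k, |D k N ω|) ^ 2
        + (∑ k, |D k N ω|) ^ 3 + w ^ 4 * (∑ k, |D k N ω|) ^ 6) μ :=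
      ((mh.mul (mr.pow 2)).add (mr.pow 3)).add ((mr.pow 6).const_mul _)
    have mE₂ : HasAllMoments (fun ω => (∑ k, |A k N ω|) * (∑ k, |D k N ω|)
        + (∑ k, |D k N ω|) ^ 2 + w ^ 4 * (∑ k, |D k N ω|) ^ 6) μ :=
      ((mh.mul mr).add (mr.pow 2)).add ((mr.pow 6).const_mul _)
    have hKe : 0 ≤ K * e ^ 6 := by positivity
    obtain ⟨c1, c2⟩ := mean_variance_estimates (hmem N) mT mq mm mE₁ mE₂ hT0 hm0 hL
      (by positivity : 0 ≤ 15 * K) he he1 hew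
      (fun ω => by rw [w4]; exact (hexp' N hN ω).1) (fun ω => by rw [w4]; exact (hexp' N hN ω).2)
      (i1.trans (by linarith)) i2 iT
    rw [hq, ← sub_sub] at c1
    rw [hTT] at c2
    refine ⟨c1.trans ?_, c2⟩
    have e65 : e ^ 6 ≤ e ^ 5 := pow_le_pow_of_le_one he.le he1 (by norm_num)
    gcongr
  exact ⟨hmem, isLittleO_one_div_of_abs_le fun N hN => (main N hN).1,
    isLittleO_one_div_of_abs_le fun N hN => (main N hN).2⟩
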